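/- **Conventions.** Constants, variables and labeled nulls form disjoint countably infinite sets. A fact is an atom over constants and nulls; an instance is a finite set of facts; $\mathrm{adom}(I)$ is the set of terms occurring in $I$. A data exchange setting $\mathcal S=\langle \mathsf S,\mathsf T,\Sigma_{st},\Sigma_t\rangle$ consists of disjoint source and target schemas, a finite set $\Sigma_{st}$ of TGDs with bodies over $\mathsf S$ and heads over $\mathsf T$, and a finite set $\Sigma_t$ of TGDs and EGDs over $\mathsf T$. It is *TGD-only* if $\Sigma_t$ has no EGDs, and *weakly-acyclic* if no cycle of the dependency graph of the TGDs of $\Sigma_t$ contains a special edge. (The nodes of this graph are the positions $R[i]$; for each TGD and each variable $x$ shared by its body and head, there is a normal edge from each body position of $x$ to each head position of $x$, and a special edge from each body position of $x$ to each head position of an existential variable.) A source instance is a null-free instance over $\mathsf S$. *Supported solutions.* An ex-choice $\gamma$ assigns to every TGD $\rho$ and every tuple of constants for its frontier variables (those shared by body and head) a constant for each existential variable of $\rho$. $\Sigma^\gamma$ is obtained from $\Sigma$ by replacing every TGD $\rho$ with all its ground versions, under maps $h$ of its variables to constants, in which the existential variables have the values prescribed by $\gamma$ for the values $h$ gives to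 the frontier. A target instance $J$ is a *supported solution* of $I$ if for some ex-choice $\gamma$ it is $\subseteq$-minimal among the target instances $J$ such that $I\cup J$ satisfies $\Sigma_{st}^\gamma$ and $J$ satisfies $\Sigma_t^\gamma$. Let $\mathrm{ssol}(I,\mathcal S)$ be the set of supported solutions. A query $Q$ is a first-order formula over $\mathsf T$ with a tuple of answer variables; $Q(J)$ is the set of its answers in $\mathrm{adom}(J)$ under active-domain semantics; $Q$ is *positive* if it is a union of conjunctive queries. Put $\mathrm{scert}(I,Q)=\bigcap_{J\in \mathrm{ssol}(I,\mathcal S)}Q(J)$. *Conditional instances.* A condition is a Boolean combination of equalities between constants and nulls. A conditional instance $\mathcal J$ is a finite set of pairs $\langle\alpha,\phi\rangle$ of a fact and a condition. A valuation $\nu$ maps nulls to constants and fixes constants; it yields the possible world $\{\nu(\alpha)\mid\langle\alpha,\phi\rangle\in\mathcal J,\ \nu\models\phi\}$. Let $\mathrm{pw}(\mathcal J)$ be the set of possible worlds and $\mathrm{ccert}(\mathcal J,Q)=\bigcap_{W\in \mathrm{pw}(\mathcal J)}Q(W)$. $\mathcal J$ is an *approximate conditional solution* of $I$ if $\mathrm{ssol}(I,\mathcal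 S)\subseteq \mathrm{pw}(\mathcal J)$ (and thus $\mathrm{ccert}(\mathcal J,Q)\subseteq\mathrm{scert}(I,Q)$ for every query $Q$ over $\mathsf T$), and $\mathrm{ccert}(\mathcal J,Q)=\mathrm{scert}(I,Q)$ for every positive query $Q$ over $\mathsf T$. *The approximation function* $\dot Q_t$ (Greco, Molinaro, Trubitsyna). Evaluate $Q$ conditionally over $\mathcal J$: for an assignment $\sigma$ of terms occurring in $\mathcal J$ to variables, an atom $R(\mathbf s)$ receives the condition $\bigvee_{\langle R(\mathbf u),\psi\rangle\in\mathcal J}(\psi\wedge\sigma(\mathbf s)=\mathbf u)$; equalities and connectives are translated literally; $\exists x$ (resp. $\forall x$) becomes a disjunction (resp. conjunction) over the terms $d$ occurring in $\mathcal J$, guarded by the condition $\delta_d=\bigvee_{\langle R(\mathbf u),\psi\rangle\in\mathcal J}\bigvee_i(\psi\wedge u_i=d)$ that $d$ is in the active domain. A tuple $\mathbf t$ of terms occurring in $\mathcal J$ gets the conjunction of the condition of $Q$ at $\mathbf t$ and the $\delta_{t_i}$. Evaluate conditions in Kleene's three-valued logic, where $t=u$ is *true* if $t,u$ are the same term, *false*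 if they are distinct constants, and *unknown* otherwise. $\dot Q_t(\mathcal J)$ is the set of tuples of constants whose condition evaluates to *true*. **Corollary.** Let $\mathcal S$ be a TGD-only weakly-acyclic setting. There is a polynomial-time algorithm that, given any source instance $I$ of $\mathcal S$, constructs an approximate conditional solution $\mathcal J$ of $I$ w.r.t. $\mathcal S$ (in time polynomial in $|I|$, with $\mathcal S$ fixed), such that for every query $Q$ over $\mathsf T$: 1. $\dot Q_t(\mathcal J)\subseteq \mathrm{ccert}(\mathcal J,Q)\subseteq \mathrm{scert}(I,Q)$; 2. if $Q$ is positive, then $\dot Q_t(\mathcal J)=\mathrm{ccert}(\mathcal J,Q)=\mathrm{scert}(I,Q)$; 3. $\dot Q_t(\mathcal J)$ is computable in polynomial time w.r.t. $|\mathcal J|$ (with $Q$ fixed); indeed one polynomial-time algorithm computes $\dot Q_t$ on all conditional instances. -/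

import Mathlib

namespace DataExchange

/-! ### Terms, atoms, instances -/

/-- Constants: a countably infinite set, realised as the set of binary strings. -/
abbrev Const := List Bool

/-- Names of labeled nulls. They are kept apart from the constants by the constructors of `Val`. -/
abbrev Null := List Bool

/-- Variables. -/
abbrev Var := ℕ

/-- Relations: for each arity there are countably many. -/
structure RelSym where
  name : List Bool
  arity : ℕ
deriving DecidableEq

/-- A schema is a (possibly infinite) set of relations. -/
abbrev Schema := Set RelSym

/-- Terms of dependencies and queries: constants and variables (no nulls). -/
inductive Term where
  | const (c : Const)
  | var (x : Var)

/-- Terms of instances: constants and labeled nulls. -/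
inductive Val where
  | const (c : Const)
  | null (n : Null)
deriving DecidableEq

/-- Atoms with arguments in `τ`. -/
structure Atom (τ : Type) where
  rel : RelSym
  args : Fin rel.arity → τ

/-- Apply a mapping to all the arguments of an atom. -/
def Atom.map {τ τ' : Type} (f : τ → τ') (a : Atom τ) : Atom τ' :=
  ⟨a.rel, fun i => f (a.args i)⟩

/-- A fact is an atom without variables (nulls are allowed). -/
abbrev DBFact := Atom Val

/-- Sets of facts. Finiteness is part of `IsInstance`. -/
abbrev Instance := Set DBFact

/-- `I` is an instance over the schema `R`: a finite set of facts over `R`. -/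
def IsInstance (R : Schema) (I : Instance) : Prop :=
  I.Finite ∧ ∀ α ∈ I, α.rel ∈ R

/-- No nulls occur in `I`. -/
def NullFree (I : Instance) : Prop :=
  ∀ α ∈ I, ∀ i, ∃ c : Const, α.args i = Val.const c

/-- The active domain. -/
def adom (I : Instance) : Set Val := {v | ∃ α ∈ I, ∃ i, α.args i = v}

/-- The value of a term under an assignment of the variables. -/
def Term.inst (h : Var → Val) : Term → Val
  | .const c => .const c
  | .var x => h x

/-- Replace the variables by constants. -/
def Term.ground (h : Var → Const) : Term → Term
  | .const c => .const c
  | .var x => .const (h x)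

/-- The variables of a conjunction of atoms. -/
def varsOf (A : List (Atom Term)) : Set Var := {x | ∃ a ∈ A, ∃ i, a.args i = Term.var x}

/-- A conjunction of atoms is over the schema `R`. -/
def AtomsOver (R : Schema) (A : List (Atom Term)) : Prop := ∀ a ∈ A, a.rel ∈ R

/-- The assignment `h` is a homomorphism from the conjunction `A` to `I`. -/
def IsHom (h : Var → Val) (A : List (Atom Term)) (I : Instance) : Prop :=
  ∀ a ∈ A, a.map (Term.inst h) ∈ I

/-! ### Dependencies -/

/-- Tuple-generating dependencies `body → ∃ z, head`; the existential variables `z` are the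
variables of the head that do not occur in the body. -/
structure TGD where
  body : List (Atom Term)
  head : List (Atom Term)

/-- The frontier: the variables shared by body and head. -/
def TGD.frontier (ρ : TGD) : Set Var := varsOf ρ.body ∩ varsOf ρ.head

/-- The existentially quantified variables. -/
def TGD.exvar (ρ : TGD) : Set Var := varsOf ρ.head \ varsOf ρ.body

/-- Satisfaction of a TGD: every homomorphism from the body extends to one from the head. -/
def TGD.Sat (I : Instance) (ρ : TGD) : Prop :=
  ∀ h : Var → Val, IsHom h ρ.body I →
    ∃ h' : Var → Val, (∀ x ∈ varsOf ρ.body, h' x = h x) ∧ IsHom h' ρ.head I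

/-- Equality-generating dependencies `body → x = y`. -/
structure EGD where
  body : List (Atom Term)
  x : Var
  y : Var
  x_mem : x ∈ varsOf body
  y_mem : y ∈ varsOf body

/-- Satisfaction of an EGD. -/
def EGD.Sat (I : Instance) (η : EGD) : Prop :=
  ∀ h : Var → Val, IsHom h η.body I → h η.x = h η.y

/-- The ground version of a TGD via `h`. -/
def TGD.groundVersion (ρ : TGD) (h : Var → Const) : TGD :=
  ⟨ρ.body.map (Atom.map (Term.ground h)), ρ.head.map (Atom.map (Term.ground h))⟩

/-- An ex-choice: for each TGD and each tuple of constants for its frontier, a constant for each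
existential variable. -/
def ExChoice : Type := (ρ : TGD) → (ρ.frontier → Const) → (ρ.exvar → Const)

/-- The ground version of `ρ` via `h` is coherent with `γ`. -/
def Coherent (γ : ExChoice) (ρ : TGD) (h : Var → Const) : Prop :=
  ∀ z : ρ.exvar, h z = γ ρ (fun x => h x) z

/-- All the ground versions of TGDs of `D` that are coherent with `γ`. -/
def coherentGround (D : Set TGD) (γ : ExChoice) : Set TGD :=
  {τ | ∃ ρ ∈ D, ∃ h : Var → Const, Coherent γ ρ h ∧ τ = ρ.groundVersion h}

/-! ### Data exchange settings -/

/-- Data exchange settings. The target dependencies are a finite set of TGDs together with a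
finite set of EGDs. -/
structure Setting where
  source : Schema
  target : Schema
  disjoint : Disjoint source target
  stTGDs : Set TGD
  tgtTGDs : Set TGD
  tgtEGDs : Set EGD
  stTGDs_finite : stTGDs.Finite
  tgtTGDs_finite : tgtTGDs.Finite
  tgtEGDs_finite : tgtEGDs.Finite
  stTGDs_over : ∀ ρ ∈ stTGDs, AtomsOver source ρ.body ∧ AtomsOver target ρ.head
  tgtTGDs_over : ∀ ρ ∈ tgtTGDs, AtomsOver target ρ.body ∧ AtomsOver target ρ.head
  tgtEGDs_over : ∀ η ∈ tgtEGDs, AtomsOver target η.body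

/-- The setting has no target EGDs. -/
def Setting.TGDOnly (S : Setting) : Prop := S.tgtEGDs = ∅

/-- Source instances are databases (no nulls). -/
def Setting.IsSourceInstance (S : Setting) (I : Instance) : Prop :=
  IsInstance S.source I ∧ NullFree I

/-- `I ∪ J` satisfies the source-to-target dependencies and `J` the target dependencies, when the
TGDs are replaced by their ground versions coherent with `γ`. -/
def Setting.SatWith (S : Setting) (γ : ExChoice) (I J : Instance) : Prop :=
  (∀ τ ∈ coherentGround S.stTGDs γ, τ.Sat (I ∪ J)) ∧
  (∀ τ ∈ coherentGround S.tgtTGDs γ, τ.Sat J) ∧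
  (∀ η ∈ S.tgtEGDs, η.Sat J)

/-- The set of supported solutions of `I`. -/
def Setting.ssol (S : Setting) (I : Instance) : Set Instance :=
  {J | IsInstance S.target J ∧ ∃ γ : ExChoice, S.SatWith γ I J ∧
    ∀ J' : Instance, IsInstance S.target J' → J' ⊂ J → ¬ S.SatWith γ I J'}

/-! ### Weak acyclicity -/

/-- Positions `R[i]`. -/
abbrev Position := (R : RelSym) × Fin R.arity

/-- The variable `x` occurs in `A` at the position `π`. -/
def OccursAt (A : List (Atom Term)) (x : Var) (π : Position) : Prop :=
  ∃ a ∈ A, ∃ i : Fin a.rel.arity, a.args i = Term.var x ∧ π = ⟨a.rel, i⟩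

/-- Normal edges of the dependency graph. -/
def NormalEdge (D : Set TGD) (π π' : Position) : Prop :=
  ∃ ρ ∈ D, ∃ x ∈ ρ.frontier, OccursAt ρ.body x π ∧ OccursAt ρ.head x π'

/-- Special edges of the dependency graph. -/
def SpecialEdge (D : Set TGD) (π π' : Position) : Prop :=
  ∃ ρ ∈ D, ∃ x ∈ ρ.frontier, OccursAt ρ.body x π ∧ ∃ z ∈ ρ.exvar, OccursAt ρ.head z π'

/-- No cycle of the dependency graph contains a special edge, i.e., no special edge leads from
`π` to a position from which `π` can be reached. -/
def WeaklyAcyclic (D : Set TGD) : Prop :=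
  ∀ π π' : Position, SpecialEdge D π π' →
    ¬ Relation.ReflTransGen (fun a b => NormalEdge D a b ∨ SpecialEdge D a b) π' π

/-- A setting is weakly-acyclic if its set of target TGDs is. -/
def Setting.WeaklyAcyclic (S : Setting) : Prop := DataExchange.WeaklyAcyclic S.tgtTGDs

/-! ### Queries -/

/-- First-order formulas. -/
inductive Formula where
  | atom (a : Atom Term)
  | eq (s t : Term)
  | neg (φ : Formula)
  | and (φ ψ : Formula)
  | or (φ ψ : Formula)
  | ex (x : Var) (φ : Formula)
  | all (x : Var) (φ : Formula)

/-- Variables of a term. -/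
def Term.vars : Term → Set Var
  | .const _ => ∅
  | .var x => {x}

/-- Free variables. -/
def Formula.freeVars : Formula → Set Var
  | .atom a => {x | ∃ i, a.args i = Term.var x}
  | .eq s t => s.vars ∪ t.vars
  | .neg φ => φ.freeVars
  | .and φ ψ => φ.freeVars ∪ ψ.freeVars
  | .or φ ψ => φ.freeVars ∪ ψ.freeVars
  | .ex x φ => φ.freeVars \ {x}
  | .all x φ => φ.freeVars \ {x}

/-- Only relations of `R` occur in the formula. -/
def Formula.Over (R : Schema) : Formula → Prop
  | .atom a => a.rel ∈ R
  | .eq _ _ => True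
  | .neg φ => φ.Over R
  | .and φ ψ => φ.Over R ∧ ψ.Over R
  | .or φ ψ => φ.Over R ∧ ψ.Over R
  | .ex _ φ => φ.Over R
  | .all _ φ => φ.Over R

/-- First-order satisfaction under the active domain semantics. -/
def Formula.Holds (I : Instance) : Formula → (Var → Val) → Prop
  | .atom a, σ => a.map (Term.inst σ) ∈ I
  | .eq s t, σ => s.inst σ = t.inst σ
  | .neg φ, σ => ¬ φ.Holds I σ
  | .and φ ψ, σ => φ.Holds I σ ∧ ψ.Holds I σ
  | .or φ ψ, σ => φ.Holds I σ ∨ ψ.Holds I σ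
  | .ex x φ, σ => ∃ d ∈ adom I, φ.Holds I (Function.update σ x d)
  | .all x φ, σ => ∀ d ∈ adom I, φ.Holds I (Function.update σ x d)

/-- Conjunctions of (relational) atoms. -/
def Formula.IsConj : Formula → Prop
  | .atom _ => True
  | .and φ ψ => φ.IsConj ∧ ψ.IsConj
  | _ => False

/-- Existentially quantified conjunctions of atoms. -/
def Formula.IsCQ : Formula → Prop
  | .ex _ φ => φ.IsCQ
  | φ => φ.IsConj

/-- Disjunctions of formulas as in `IsCQ`. -/
def Formula.IsUCQ : Formula → Prop
  | .or φ ψ => φ.IsUCQ ∧ ψ.IsUCQ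
  | φ => φ.IsCQ

/-- A query `Q(x)`: a formula with a tuple of answer variables, among which are all its free
variables. -/
structure Query where
  arity : ℕ
  head : Fin arity → Var
  formula : Formula
  freeVars_subset : formula.freeVars ⊆ Set.range head

/-- Queries over a schema. -/
def Query.Over (R : Schema) (Q : Query) : Prop := Q.formula.Over R

/-- Positive queries are unions of conjunctive queries. -/
def Query.IsPositive (Q : Query) : Prop := Q.formula.IsUCQ

/-- The output of `Q` over `I`: the tuples over the active domain that satisfy the formula. -/
def Query.answers (Q : Query) (I : Instance) : Set (Fin Q.arity → Val) :=
  {t | (∀ i, t i ∈ adom I) ∧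
    ∃ σ : Var → Val, (∀ i, σ (Q.head i) = t i) ∧ Q.formula.Holds I σ}

/-- The supported certain answers. -/
def Setting.scert (S : Setting) (I : Instance) (Q : Query) : Set (Fin Q.arity → Val) :=
  ⋂ J ∈ S.ssol I, Q.answers J

/-! ### Conditional instances -/

/-- Conditions: Boolean combinations of equalities between constants and nulls. -/
inductive Condition where
  | tru
  | fls
  | eq (t u : Val)
  | neg (φ : Condition)
  | and (φ ψ : Condition)
  | or (φ ψ : Condition)
  | imp (φ ψ : Condition)

/-- A valuation, given by its values on nulls, acts on terms as the identity on constants. -/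
def applyVal (ν : Null → Const) : Val → Val
  | .const c => .const c
  | .null n => .const (ν n)

/-- The valuation satisfies the condition. -/
def Condition.Sat (ν : Null → Const) : Condition → Prop
  | .tru => True
  | .fls => False
  | .eq t u => applyVal ν t = applyVal ν u
  | .neg φ => ¬ φ.Sat ν
  | .and φ ψ => φ.Sat ν ∧ ψ.Sat ν
  | .or φ ψ => φ.Sat ν ∨ ψ.Sat ν
  | .imp φ ψ => φ.Sat ν → ψ.Sat ν

/-- Conditional facts. -/
abbrev CFact := DBFact × Condition

/-- A conditional instance is a finite set of conditional facts, presented by a list of its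
elements; its possible worlds depend only on which elements the list has. -/
abbrev CInstance := List CFact

/-- The possible world of `J` under a valuation. -/
def CInstance.world (J : CInstance) (ν : Null → Const) : Instance :=
  {β | ∃ p ∈ J, p.2.Sat ν ∧ β = p.1.map (applyVal ν)}

/-- The set of possible worlds. -/
def CInstance.pw (J : CInstance) : Set Instance := {W | ∃ ν : Null → Const, W = J.world ν}

/-- The conditional certain answers. -/
def CInstance.ccert (J : CInstance) (Q : Query) : Set (Fin Q.arity → Val) :=
  ⋂ W ∈ J.pw, Q.answers W

/-- `J` is an approximate conditional solution of `I`. -/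
def Setting.IsApproxCondSol (S : Setting) (I : Instance) (J : CInstance) : Prop :=
  S.ssol I ⊆ J.pw ∧
  ∀ Q : Query, Q.Over S.target →
    J.ccert Q ⊆ S.scert I Q ∧ (Q.IsPositive → J.ccert Q = S.scert I Q)

/-! ### Approximate answers through conditional evaluation

A query is evaluated over a conditional instance to a set of conditional tuples `⟨t, φ⟩`; the
conditions are then evaluated in three-valued logic, and the tuples whose condition evaluates to
*true* are returned. -/

/-- Finite disjunctions. -/
def Condition.disj (l : List Condition) : Condition := l.foldr Condition.or Condition.fls

/-- Finite conjunctions. -/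
def Condition.conj (l : List Condition) : Condition := l.foldr Condition.and Condition.tru

/-- The condition under which two facts coincide. -/
def matchCond (a b : DBFact) : Condition :=
  if a.rel = b.rel then
    Condition.conj (List.zipWith Condition.eq (List.ofFn a.args) (List.ofFn b.args))
  else Condition.fls

/-- The terms occurring in the facts of `J`. -/
def CInstance.terms (J : CInstance) : List Val := J.flatMap fun p => List.ofFn p.1.args

/-- The condition under which `d` belongs to the active domain of the possible world. -/
def CInstance.domCond (J : CInstance) (d : Val) : Condition :=
  Condition.disj (J.flatMap fun p =>
    (List.ofFn p.1.args).map fun u => Condition.and p.2 (Condition.eq u d))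

/-- Conditional evaluation of a formula: the condition under which it holds, for an assignment of
the variables to terms. -/
def CInstance.condEval (J : CInstance) : Formula → (Var → Val) → Condition
  | .atom a, σ =>
      Condition.disj (J.map fun p => Condition.and p.2 (matchCond (a.map (Term.inst σ)) p.1))
  | .eq s t, σ => Condition.eq (s.inst σ) (t.inst σ)
  | .neg φ, σ => Condition.neg (J.condEval φ σ)
  | .and φ ψ, σ => Condition.and (J.condEval φ σ) (J.condEval ψ σ)
  | .or φ ψ, σ => Condition.or (J.condEval φ σ) (J.condEval ψ σ)
  | .ex x φ, σ =>
      Condition.disj (J.terms.map fun d =>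
        Condition.and (J.domCond d) (J.condEval φ (Function.update σ x d)))
  | .all x φ, σ =>
      Condition.conj (J.terms.map fun d =>
        Condition.imp (J.domCond d) (J.condEval φ (Function.update σ x d)))

/-- The conditional table obtained by the conditional evaluation of `Q` over `J`. -/
def CInstance.condAnswers (J : CInstance) (Q : Query) : Set ((Fin Q.arity → Val) × Condition) :=
  {p | ∃ σ : Var → Val, (∀ i, σ (Q.head i) ∈ J.terms) ∧ (∀ i, p.1 i = σ (Q.head i)) ∧
    p.2 = Condition.and (Condition.conj (List.ofFn fun i => J.domCond (σ (Q.head i))))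
      (J.condEval Q.formula σ)}

/-- Three-valued evaluation of an equality: `1` is *true*, `-1` is *false*, `0` is *unknown*. -/
def evalEq (t u : Val) : SignType :=
  if t = u then 1
  else match t, u with
    | .const _, .const _ => -1
    | _, _ => 0

/-- Three-valued (Kleene) evaluation of conditions: `-1 < 0 < 1` are *false*, *unknown*, *true*. -/
def Condition.eval : Condition → SignType
  | .tru => 1
  | .fls => -1
  | .eq t u => evalEq t u
  | .neg φ => -φ.eval
  | .and φ ψ => min φ.eval ψ.eval
  | .or φ ψ => max φ.eval ψ.eval
  | .imp φ ψ => max (-φ.eval) ψ.eval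

/-- The approximate answers to `Q` over `J`: the tuples of constants whose condition in the
conditional table of `Q` evaluates to *true*. -/
def Query.trueAnswers (Q : Query) (J : CInstance) : Set (Fin Q.arity → Val) :=
  {t | (∀ i, ∃ c : Const, t i = Val.const c) ∧ ∃ φ, (t, φ) ∈ J.condAnswers Q ∧ φ.eval = 1}

/-! ### Polynomial time

The programs are those of a while-language over binary trees. Every instruction is charged at
least the size of the data it reads, copies or builds, so that running times agree, up to a
polynomial, with those of multi-tape Turing machines, and a program cannot build an output larger
than its running time. -/

/-- Binary trees, the data of programs. -/
inductive Data where
  | leaf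
  | node (l r : Data)

/-- The number of nodes. -/
def Data.size : Data → ℕ
  | .leaf => 1
  | .node l r => l.size + r.size + 1

/-- Programs. -/
inductive Prog where
  | skip
  | leaf
  | fst
  | snd
  | eq
  | pair (p q : Prog)
  | seq (p q : Prog)
  | ite (c p q : Prog)
  | loop (c p : Prog)

/-- `Runs p x y n`: on input `x` the program `p` halts with output `y` after `n` steps.
A test succeeds if it returns a tree other than `leaf`. -/
inductive Runs : Prog → Data → Data → ℕ → Prop where
  | skip (x : Data) : Runs .skip x x x.size
  | leaf (x : Data) : Runs .leaf x .leaf x.size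
  | fst_leaf : Runs .fst .leaf .leaf 1
  | fst_node (x y : Data) : Runs .fst (.node x y) x (Data.node x y).size
  | snd_leaf : Runs .snd .leaf .leaf 1
  | snd_node (x y : Data) : Runs .snd (.node x y) y (Data.node x y).size
  | eq_leaf : Runs .eq .leaf .leaf 1
  | eq_same (x : Data) : Runs .eq (.node x x) (.node .leaf .leaf) (Data.node x x).size
  | eq_diff (x y : Data) (h : x ≠ y) : Runs .eq (.node x y) .leaf (Data.node x y).size
  | pair {p q : Prog} {x y z : Data} {m n : ℕ} (hp : Runs p x y m) (hq : Runs q x z n) :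
      Runs (.pair p q) x (.node y z) (m + n + x.size + 1)
  | seq {p q : Prog} {x y z : Data} {m n : ℕ} (hp : Runs p x y m) (hq : Runs q y z n) :
      Runs (.seq p q) x z (m + n + 1)
  | ite_true {c p q : Prog} {x a b y : Data} {m n : ℕ}
      (hc : Runs c x (.node a b) m) (hp : Runs p x y n) :
      Runs (.ite c p q) x y (m + n + x.size + 1)
  | ite_false {c p q : Prog} {x y : Data} {m n : ℕ}
      (hc : Runs c x .leaf m) (hq : Runs q x y n) :
      Runs (.ite c p q) x y (m + n + x.size + 1)
  | loop_done {c p : Prog} {x : Data} {m : ℕ} (hc : Runs c x .leaf m) :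
      Runs (.loop c p) x x (m + x.size + 1)
  | loop_step {c p : Prog} {x a b y z : Data} {m n k : ℕ}
      (hc : Runs c x (.node a b) m) (hp : Runs p x y n) (hl : Runs (.loop c p) y z k) :
      Runs (.loop c p) x z (m + n + k + x.size + 1)

/-- Under the encodings `ea` and `eb`, the function `f` is computed on all inputs from `D` by one
program whose running time is bounded by a polynomial in the size of the input. -/
def PolyTimeOn {α β : Type} (D : Set α) (ea : α → Data) (eb : β → Data) (f : α → β) : Prop :=
  ∃ (p : Prog) (P : Polynomial ℕ), ∀ a ∈ D, ∃ n : ℕ,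
    Runs p (ea a) (eb (f a)) n ∧ n ≤ P.eval (ea a).size

/-! ### Encodings -/

/-- Lists. -/
def encList {α : Type} (e : α → Data) : List α → Data
  | [] => .leaf
  | a :: l => .node (e a) (encList e l)

/-- Truth values. -/
def encBool : Bool → Data
  | false => .leaf
  | true => .node .leaf .leaf

/-- Binary strings. -/
def encString (s : List Bool) : Data := encList encBool s

/-- Constants and nulls. -/
def encVal : Val → Data
  | .const c => .node .leaf (encString c)
  | .null n => .node (.node .leaf .leaf) (encString n)

/-- Facts: the name of the relation and the list of the arguments (whose length is the arity). -/
def encFact (α : DBFact) : Data := .node (encString α.rel.name) (encList encVal (List.ofFn α.args))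

/-- A small number, in unary, used as a tag. -/
def encTag : ℕ → Data
  | 0 => .leaf
  | n + 1 => .node .leaf (encTag n)

/-- Conditions. -/
def encCond : Condition → Data
  | .tru => .node (encTag 0) .leaf
  | .fls => .node (encTag 1) .leaf
  | .eq t u => .node (encTag 2) (.node (encVal t) (encVal u))
  | .neg φ => .node (encTag 3) (encCond φ)
  | .and φ ψ => .node (encTag 4) (.node (encCond φ) (encCond ψ))
  | .or φ ψ => .node (encTag 5) (.node (encCond φ) (encCond ψ))
  | .imp φ ψ => .node (encTag 6) (.node (encCond φ) (encCond ψ))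

/-- Finite sets of facts, given as lists. -/
def encFacts (L : List DBFact) : Data := encList encFact L

/-- Conditional instances. -/
def encCInstance (J : CInstance) : Data :=
  encList (fun p : CFact => Data.node (encFact p.1) (encCond p.2)) J

/-- Finite sets of tuples, given as lists. -/
def encTuples {k : ℕ} (T : List (Fin k → Val)) : Data :=
  encList (fun t => encList encVal (List.ofFn t)) T

end DataExchange

open DataExchange

/-! An ex-choice interprets the Skolem functions of the TGDs by constants. The chase with these
functions is the least model of the corresponding ground TGDs, so without EGDs, and once chases are
finite, the supported solutions of `I` are exactly these chases (`Setting.mem_ssol`). Weak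
acyclicity bounds, independently of `I`, the number of rounds of Skolem applications that produce
all values (`Setting.chase_subset_candidates`); every chase therefore consists of facts from a list
of candidates of size polynomial in `I`.

The conditional instance `condSolution` has two layers. The facts of the chase with free Skolem
functions, where each Skolem term is a null of its own, are unconditional. Every candidate fact over
these nulls is added under the condition that a flag null belonging to it equals a fixed constant.
Given an ex-choice, a valuation can interpret the Skolem nulls accordingly and switch on exactly the
candidates whose image lies in the solution. The unconditional facts map into the solution anyway,
so the world is the solution itself (`Setting.ssol_subset_pw`). There may be further worlds, but
only an inclusion is needed.

For positive queries a circle of inclusions closes: true answers are conditional certain answers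
(soundness of Kleene evaluation, `Query.trueAnswers_subset_ccert`), these are supported certain
answers, and these are true answers (`Setting.scert_subset_trueAnswers`). For the last inclusion,
take an ex-choice that codes Skolem terms as fresh constants (`Setting.exists_exChoice`). Decoding
maps its solution homomorphically to the free chase and fixes all relevant constants. Positive
queries survive homomorphisms, and on unconditional facts they evaluate to true.

Polynomial time rests on closure properties of `PolyTime`: composition, tests, and folds with
additive growth. Whatever depends on the setting or the query alone is unfolded into the program.
The conditions stored in the input have unbounded depth and are evaluated by a stack machine. -/

namespace DataExchange

/-! ### Encoded types and polynomial bounds -/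

/-- Types whose elements are encoded as data of programs. -/
class Enc (α : Type) where
  enc : α → Data


/-- The size of the encoding. -/
def sz {α : Type} [Enc α] (a : α) : ℕ := (Enc.enc a).size

instance : Enc Data := ⟨id⟩
instance : Enc Bool := ⟨encBool⟩
instance {α : Type} [Enc α] : Enc (List α) := ⟨encList Enc.enc⟩
instance {α β : Type} [Enc α] [Enc β] : Enc (α × β) := ⟨fun p => .node (Enc.enc p.1) (Enc.enc p.2)⟩
instance : Enc Val := ⟨encVal⟩
instance : Enc DBFact := ⟨encFact⟩
instance : Enc Condition := ⟨encCond⟩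
instance {k : ℕ} : Enc (Fin k → Val) := ⟨fun t => encList encVal (List.ofFn t)⟩

/-- One step of a left fold with a context. -/
def foldStep {α β ξ : Type} (f : ξ → β → α → β) : ξ × β × List α → ξ × β × List α
  | (x, b, []) => (x, b, [])
  | (x, b, a :: l) => (x, f x b a, l)

theorem foldStep_iterate {α β ξ : Type} (f : ξ → β → α → β) (x : ξ) (b : β) (l : List α) (i : ℕ) :
    (foldStep f)^[i] (x, b, l) = (x, (l.take i).foldl (f x) b, l.drop i) := by
  induction i generalizing b l with
  | zero => simp
  | succ i ih => cases l <;> simp [foldStep, ih]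

section
variable {α β γ δ ξ : Type} [Enc α] [Enc β] [Enc γ] [Enc δ] [Enc ξ]

theorem sz_nil : sz ([] : List α) = 1 := rfl

theorem sz_cons (a : α) (l : List α) : sz (a :: l) = sz a + sz l + 1 := rfl

theorem sz_prod (a : α) (b : β) : sz (a, b) = sz a + sz b + 1 := rfl

theorem Data.size_pos (d : Data) : 0 < d.size := by cases d <;> simp [Data.size]

theorem sz_pos (a : α) : 0 < sz a := Data.size_pos _

theorem length_le_sz (l : List α) : l.length ≤ sz l := by
  induction l with
  | nil => simp
  | cons a l ih => rw [sz_cons, List.length_cons]; omega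

theorem sz_le_of_mem {a : α} {l : List α} (h : a ∈ l) : sz a + 1 ≤ sz l := by
  induction l with
  | nil => simp at h
  | cons b l ih =>
    rw [sz_cons]
    rcases List.mem_cons.1 h with rfl | h
    · have := sz_pos l; omega
    · have := ih h; omega

theorem sz_sublist {l l' : List α} (h : l.Sublist l') : sz l ≤ sz l' := by
  induction h with
  | slnil => rfl
  | cons a _ ih => rw [sz_cons]; omega
  | cons_cons a _ ih => rw [sz_cons, sz_cons]; omega

theorem sz_append (l l' : List α) : sz (l ++ l') + 1 = sz l + sz l' := by
  induction l with
  | nil => simp [sz_nil, Nat.add_comm]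
  | cons a l ih => rw [List.cons_append, sz_cons, sz_cons]; omega

theorem eval_mono (P : Polynomial ℕ) {m n : ℕ} (h : m ≤ n) : P.eval m ≤ P.eval n := by
  rw [Polynomial.eval_eq_sum, Polynomial.eval_eq_sum]
  exact Finset.sum_le_sum fun i _ => Nat.mul_le_mul_left _ (Nat.pow_le_pow_left h i)

/-- `t` is bounded by a polynomial in the size of its argument. -/
def PolyBounded (t : ξ → ℕ) : Prop := ∃ P : Polynomial ℕ, ∀ x, t x ≤ P.eval (sz x)

theorem PolyBounded.mono {t u : ξ → ℕ} (h : PolyBounded u) (htu : ∀ x, t x ≤ u x) :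
    PolyBounded t :=
  let ⟨P, hP⟩ := h
  ⟨P, fun x => (htu x).trans (hP x)⟩

theorem PolyBounded.const (c : ℕ) : PolyBounded fun _ : ξ => c :=
  ⟨Polynomial.C c, fun x => by simp⟩

theorem PolyBounded.sz : PolyBounded fun x : ξ => sz x :=
  ⟨Polynomial.X, fun x => by simp⟩

theorem PolyBounded.add {t u : ξ → ℕ} (ht : PolyBounded t) (hu : PolyBounded u) :
    PolyBounded fun x => t x + u x :=
  let ⟨P, hP⟩ := ht
  let ⟨R, hR⟩ := hu
  ⟨P + R, fun x => by rw [Polynomial.eval_add]; exact Nat.add_le_add (hP x) (hR x)⟩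

theorem PolyBounded.mul {t u : ξ → ℕ} (ht : PolyBounded t) (hu : PolyBounded u) :
    PolyBounded fun x => t x * u x :=
  let ⟨P, hP⟩ := ht
  let ⟨R, hR⟩ := hu
  ⟨P * R, fun x => by rw [Polynomial.eval_mul]; exact Nat.mul_le_mul (hP x) (hR x)⟩

theorem PolyBounded.eval (P : Polynomial ℕ) {t : ξ → ℕ} (ht : PolyBounded t) :
    PolyBounded fun x => P.eval (t x) :=
  let ⟨R, hR⟩ := ht
  ⟨P.comp R, fun x => by rw [Polynomial.eval_comp]; exact eval_mono P (hR x)⟩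

/-! ### Running times -/

/-- On input `x` the program `p` halts with output `y` after at most `N` steps. -/
def RunsIn (p : Prog) (x y : Data) (N : ℕ) : Prop := ∃ n, Runs p x y n ∧ n ≤ N

theorem RunsIn.mono {p : Prog} {x y : Data} {M N : ℕ} (h : RunsIn p x y M) (hMN : M ≤ N) :
    RunsIn p x y N :=
  let ⟨n, hr, hn⟩ := h
  ⟨n, hr, hn.trans hMN⟩

theorem RunsIn.skip (x : Data) : RunsIn .skip x x x.size := ⟨_, .skip x, le_rfl⟩

theorem RunsIn.fst (x y : Data) : RunsIn .fst (.node x y) x (Data.node x y).size :=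
  ⟨_, .fst_node x y, le_rfl⟩

theorem RunsIn.snd (x y : Data) : RunsIn .snd (.node x y) y (Data.node x y).size :=
  ⟨_, .snd_node x y, le_rfl⟩

theorem RunsIn.pair {p q : Prog} {x y z : Data} {M N : ℕ} (hp : RunsIn p x y M)
    (hq : RunsIn q x z N) : RunsIn (.pair p q) x (.node y z) (M + N + x.size + 1) :=
  let ⟨_, hr, _⟩ := hp
  let ⟨_, hs, _⟩ := hq
  ⟨_, .pair hr hs, by omega⟩

theorem RunsIn.seq {p q : Prog} {x y z : Data} {M N : ℕ} (hp : RunsIn p x y M)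
    (hq : RunsIn q y z N) : RunsIn (.seq p q) x z (M + N + 1) :=
  let ⟨_, hr, _⟩ := hp
  let ⟨_, hs, _⟩ := hq
  ⟨_, .seq hr hs, by omega⟩

/-- The sequence `s` is the trace of the loop. Each round pays for the test, the body and the size
of the current state, each at most `T`, plus one; the final failing test is the extra round. -/
theorem RunsIn.loop {c p : Prog} (k T : ℕ) (s : ℕ → Data)
    (hc : ∀ i < k, ∃ a b, RunsIn c (s i) (.node a b) T)
    (hp : ∀ i < k, RunsIn p (s i) (s (i + 1)) T)
    (hdone : RunsIn c (s k) .leaf T) (hsz : ∀ i ≤ k, (s i).size ≤ T) :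
    RunsIn (.loop c p) (s 0) (s k) ((k + 1) * (3 * T + 1)) := by
  induction k generalizing s with
  | zero =>
    obtain ⟨m, hm, hmT⟩ := hdone
    exact ⟨_, .loop_done hm, by have := hsz 0 le_rfl; omega⟩
  | succ k ih =>
    obtain ⟨a, b, m, hm, hmT⟩ := hc 0 (by omega)
    obtain ⟨n, hn, hnT⟩ := hp 0 (by omega)
    obtain ⟨r, hr, hrT⟩ := ih (fun i => s (i + 1)) (fun i hi => hc (i + 1) (by omega))
      (fun i hi => hp (i + 1) (by omega)) hdone (fun i hi => hsz (i + 1) (by omega))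
    refine ⟨_, .loop_step hm hn hr, ?_⟩
    have := hsz 0 (by omega)
    have e : (k + 1 + 1) * (3 * T + 1) = (k + 1) * (3 * T + 1) + (3 * T + 1) := by ring
    omega

/-- Every instruction is charged for what it builds. Hence outputs of polynomial-time programs have
polynomial size, which is what makes composition work. -/
theorem Runs.size_le {p : Prog} {x y : Data} {n : ℕ} (h : Runs p x y n) : y.size ≤ n := by
  induction h with
  | leaf x => exact Data.size_pos x
  | eq_same x => have := Data.size_pos x; simp [Data.size]; omega
  | _ => (try simp only [Data.size] at *); omega

/-! ### Functions computable in polynomial time -/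

/-- The function is computable in polynomial time on all inputs. -/
def PolyTime (f : α → β) : Prop := PolyTimeOn Set.univ Enc.enc Enc.enc f

theorem PolyTime.intro {f : α → β} (p : Prog) {t : α → ℕ} (ht : PolyBounded t)
    (h : ∀ a, RunsIn p (Enc.enc a) (Enc.enc (f a)) (t a)) : PolyTime f := by
  obtain ⟨P, hP⟩ := ht
  refine ⟨p, P, fun a _ => ?_⟩
  obtain ⟨n, hr, hn⟩ := h a
  exact ⟨n, hr, hn.trans (hP a)⟩

theorem PolyTime.elim {f : α → β} (h : PolyTime f) :
    ∃ (p : Prog) (P : Polynomial ℕ), ∀ a, RunsIn p (Enc.enc a) (Enc.enc (f a)) (P.eval (sz a)) := by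
  obtain ⟨p, P, h⟩ := h
  exact ⟨p, P, fun a => h a trivial⟩

theorem PolyTime.polyBounded {f : α → β} (h : PolyTime f) : PolyBounded fun a => sz (f a) := by
  obtain ⟨p, P, h⟩ := h
  refine ⟨P, fun a => ?_⟩
  obtain ⟨n, hr, hn⟩ := h a trivial
  exact hr.size_le.trans hn

/-- Only the encodings of the values matter. -/
theorem PolyTime.of_enc_eq {f : α → β} {g : α → γ} (hf : PolyTime f)
    (h : ∀ a, Enc.enc (g a) = Enc.enc (f a)) : PolyTime g := by
  obtain ⟨p, P, hp⟩ := hf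
  exact ⟨p, P, fun a ha => by rw [h]; exact hp a ha⟩

theorem PolyTime.congr {f g : α → β} (hf : PolyTime f) (h : ∀ a, g a = f a) : PolyTime g :=
  hf.of_enc_eq fun a => by rw [h]

theorem PolyTime.of_enc {f : α → β} (hf : PolyTime f) : PolyTime fun a => Enc.enc (f a) :=
  hf.of_enc_eq fun _ => rfl

theorem PolyTime.id : PolyTime fun a : α => a :=
  .intro .skip .sz fun _ => .skip _

theorem PolyTime.comp {g : β → γ} {f : α → β} (hg : PolyTime g) (hf : PolyTime f) :
    PolyTime fun a => g (f a) := by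
  obtain ⟨p, P, hp⟩ := hf.elim
  obtain ⟨q, R, hq⟩ := hg.elim
  exact .intro (.seq p q)
    (((PolyBounded.sz.eval P).add (hf.polyBounded.eval R)).add (.const 1))
    fun a => (hp a).seq (hq (f a))

theorem PolyTime.pair {f : α → β} {g : α → γ} (hf : PolyTime f) (hg : PolyTime g) :
    PolyTime fun a => (f a, g a) := by
  obtain ⟨p, P, hp⟩ := hf.elim
  obtain ⟨q, R, hq⟩ := hg.elim
  exact .intro (.pair p q)
    ((((PolyBounded.sz.eval P).add (PolyBounded.sz.eval R)).add .sz).add (.const 1))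
    fun a => (hp a).pair (hq a)

theorem PolyTime.comp₂ {h : β × γ → δ} {f : α → β} {g : α → γ} (hh : PolyTime h)
    (hf : PolyTime f) (hg : PolyTime g) : PolyTime fun a => h (f a, g a) :=
  hh.comp (hf.pair hg)

theorem PolyTime.fst {f : ξ → α × β} (hf : PolyTime f) : PolyTime fun x => (f x).1 :=
  PolyTime.comp (g := Prod.fst) (.intro .fst .sz fun _ => .fst _ _) hf

theorem PolyTime.snd {f : ξ → α × β} (hf : PolyTime f) : PolyTime fun x => (f x).2 :=
  PolyTime.comp (g := Prod.snd) (.intro .snd .sz fun _ => .snd _ _) hf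

theorem PolyTime.const (b : β) : PolyTime fun _ : α => b := by
  -- Only the encoding matters, and a fixed tree is assembled by a program of the same shape from
  -- `leaf` and `pair`.
  suffices h : ∀ d : Data, PolyTime fun _ : α => d from (h (Enc.enc b)).of_enc_eq fun _ => rfl
  intro d
  induction d with
  | leaf => exact .intro .leaf .sz fun a => ⟨_, .leaf _, le_rfl⟩
  | node l r hl hr => exact (hl.pair hr).of_enc_eq fun _ => rfl

/-- The left subtree. -/
def Data.left : Data → Data
  | .leaf => .leaf
  | .node l _ => l

/-- The right subtree. -/
def Data.right : Data → Data
  | .leaf => .leaf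
  | .node _ r => r

theorem PolyTime.left {f : ξ → Data} (hf : PolyTime f) : PolyTime fun x => (f x).left := by
  refine PolyTime.comp (g := Data.left) (.intro .fst .sz fun a => ?_) hf
  cases a with
  | leaf => exact ⟨_, .fst_leaf, le_rfl⟩
  | node l r => exact .fst l r

theorem PolyTime.right {f : ξ → Data} (hf : PolyTime f) : PolyTime fun x => (f x).right := by
  refine PolyTime.comp (g := Data.right) (.intro .snd .sz fun a => ?_) hf
  cases a with
  | leaf => exact ⟨_, .snd_leaf, le_rfl⟩
  | node l r => exact .snd l r

/-! ### Tests -/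

/-- The predicate is decidable in polynomial time. -/
def PolyTest (P : ξ → Prop) : Prop := ∃ b : ξ → Bool, PolyTime b ∧ ∀ x, b x = true ↔ P x

theorem PolyTest.congr {P R : ξ → Prop} (h : PolyTest P) (hPR : ∀ x, R x ↔ P x) : PolyTest R :=
  let ⟨b, hb, h⟩ := h
  ⟨b, hb, fun x => (h x).trans (hPR x).symm⟩

theorem PolyTest.const (p : Prop) : PolyTest fun _ : ξ => p := by
  classical exact ⟨fun _ => decide p, .const _, by simp⟩

theorem PolyTime.ite {P : ξ → Prop} [DecidablePred P] {f g : ξ → β} (hP : PolyTest P)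
    (hf : PolyTime f) (hg : PolyTime g) : PolyTime fun x => if P x then f x else g x := by
  obtain ⟨b, hb, hbP⟩ := hP
  obtain ⟨c, C, hc⟩ := hb.elim
  obtain ⟨p, F, hp⟩ := hf.elim
  obtain ⟨q, G, hq⟩ := hg.elim
  refine .intro (.ite c p q) (((((PolyBounded.sz.eval C).add (PolyBounded.sz.eval F)).add
    (PolyBounded.sz.eval G)).add .sz).add (.const 1)) fun x => ?_
  obtain ⟨m, hm, hmC⟩ := hc x
  by_cases h : P x
  · obtain ⟨n, hn, hnF⟩ := hp x
    rw [(hbP x).2 h] at hm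
    rw [if_pos h]
    exact ⟨_, .ite_true hm hn, by simp only [sz] at *; omega⟩
  · obtain ⟨n, hn, hnG⟩ := hq x
    rw [Bool.eq_false_iff.2 fun e => h ((hbP x).1 e)] at hm
    rw [if_neg h]
    exact ⟨_, .ite_false hm hn, by simp only [sz] at *; omega⟩

theorem PolyTest.not {P : ξ → Prop} (h : PolyTest P) : PolyTest fun x => ¬ P x := by
  classical
  exact ⟨_, PolyTime.ite h (.const false) (.const true), fun x => by by_cases h : P x <;> simp [h]⟩

theorem PolyTest.and {P R : ξ → Prop} (hP : PolyTest P) (hR : PolyTest R) :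
    PolyTest fun x => P x ∧ R x := by
  obtain ⟨b, hb, hbR⟩ := hR
  classical
  exact ⟨_, PolyTime.ite hP hb (.const false), fun x => by by_cases h : P x <;> simp [h, hbR]⟩

theorem PolyTest.eq_data {f g : ξ → Data} (hf : PolyTime f) (hg : PolyTime g) :
    PolyTest fun x => f x = g x := by
  classical
  refine ⟨fun x => decide (f x = g x), PolyTime.comp₂ (h := fun p : Data × Data =>
    decide (p.1 = p.2)) (.intro .eq .sz fun ⟨x, y⟩ => ?_) hf hg, by simp⟩
  by_cases h : x = y
  · subst h
    simp only [decide_true]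
    exact ⟨_, .eq_same x, le_rfl⟩
  · simp only [h, decide_false]
    exact ⟨_, .eq_diff x y h, le_rfl⟩

theorem PolyTest.eq (hinj : Function.Injective (Enc.enc : β → Data)) {f g : ξ → β}
    (hf : PolyTime f) (hg : PolyTime g) : PolyTest fun x => f x = g x :=
  (PolyTest.eq_data hf.of_enc hg.of_enc).congr fun _ => hinj.eq_iff.symm

theorem PolyTest.ball_fixed {ι : Type} (s : List ι) {P : ι → ξ → Prop}
    (h : ∀ i ∈ s, PolyTest (P i)) : PolyTest fun x => ∀ i ∈ s, P i x := by
  induction s with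
  | nil => exact (PolyTest.const True).congr (by simp)
  | cons i s ih =>
    exact ((h i (by simp)).and (ih fun j hj => h j (by simp [hj]))).congr (by simp)

theorem PolyTest.bex_fixed {ι : Type} (s : List ι) {P : ι → ξ → Prop}
    (h : ∀ i ∈ s, PolyTest (P i)) : PolyTest fun x => ∃ i ∈ s, P i x :=
  (PolyTest.ball_fixed s fun i hi => (h i hi).not).not.congr (by simp)

/-! ### Iteration -/

/-- Iterating a step, for a number of times given by a test, while sizes stay bounded. -/
theorem PolyTime.iterate {init : ξ → β} {step : β → β} {T : β → Prop} {N : ξ → ℕ}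
    (hinit : PolyTime init) (hstep : PolyTime step) (hT : PolyTest T) (hN : PolyBounded N)
    (htrue : ∀ x, ∀ i < N x, T (step^[i] (init x))) (hfalse : ∀ x, ¬ T (step^[N x] (init x)))
    {S : ξ → ℕ} (hS : PolyBounded S) (hsz : ∀ x, ∀ i ≤ N x, sz (step^[i] (init x)) ≤ S x) :
    PolyTime fun x => step^[N x] (init x) := by
  obtain ⟨b, hb, hbT⟩ := hT
  obtain ⟨c, C, hc⟩ := hb.elim
  obtain ⟨p, F, hp⟩ := hstep.elim
  obtain ⟨q, G, hq⟩ := hinit.elim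
  let M : ξ → ℕ := fun x => C.eval (S x) + F.eval (S x) + S x
  have hM : PolyBounded M := ((hS.eval C).add (hS.eval F)).add hS
  refine .intro (.seq q (.loop c p)) (((PolyBounded.sz.eval G).add ((hN.add (.const 1)).mul
    (((PolyBounded.const 3).mul hM).add (.const 1)))).add (.const 1)) fun x => ?_
  refine (hq x).seq (RunsIn.loop (N x) (M x) (fun i => Enc.enc (step^[i] (init x)))
    (fun i hi => ⟨.leaf, .leaf, ?_⟩) (fun i hi => ?_) ?_ fun i hi => ?_)
  · have h1 := hc (step^[i] (init x))
    rw [(hbT _).2 (htrue x i hi)] at h1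
    exact h1.mono ((eval_mono C (hsz x i hi.le)).trans (by simp only [M]; omega))
  · have h1 := hp (step^[i] (init x))
    rw [← Function.iterate_succ_apply' step] at h1
    exact h1.mono ((eval_mono F (hsz x i hi.le)).trans (by simp only [M]; omega))
  · have h1 := hc (step^[N x] (init x))
    rw [Bool.eq_false_iff.2 fun e => hfalse x ((hbT _).1 e)] at h1
    exact h1.mono ((eval_mono C (hsz x _ le_rfl)).trans (by simp only [M]; omega))
  · exact (hsz x i hi).trans (by simp only [M]; omega)

theorem enc_list_eq_leaf (l : List α) : Enc.enc l = .leaf ↔ l = [] := by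
  cases l <;> simp [Enc.enc, encList]

theorem PolyTest.eq_nil {l : ξ → List α} (hl : PolyTime l) : PolyTest fun x => l x = [] :=
  (PolyTest.eq_data hl.of_enc (.const .leaf)).congr fun _ => (enc_list_eq_leaf _).symm

/-- The test returns the remaining list itself, which is `leaf` exactly when the list is empty. The
constants 20 generously cover the projections and copies around the single call of the program for
`f`. -/
theorem PolyTime.foldStep {f : ξ → β → α → β}
    (hf : PolyTime fun p : ξ × β × α => f p.1 p.2.1 p.2.2) : PolyTime (foldStep f) := by
  obtain ⟨p, F, hp⟩ := hf.elim
  refine .intro (.ite (.seq .snd .snd) (.pair .fst (.pair (.seq (.pair .fst (.pair (.seq .snd .fst)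
    (.seq .snd (.seq .snd .fst)))) p) (.seq .snd (.seq .snd .snd)))) .skip)
    (t := fun s => F.eval (sz s) + 20 * sz s + 20)
    (((PolyBounded.sz.eval F).add ((PolyBounded.const 20).mul .sz)).add (.const 20)) ?_
  rintro ⟨x, b, l⟩
  cases l with
  | nil =>
    obtain ⟨m, hm, hmT⟩ := (RunsIn.snd (Enc.enc x) (Enc.enc (b, ([] : List α)))).seq
      (.snd (Enc.enc b) (Enc.enc ([] : List α)))
    refine ⟨_, .ite_false hm (.skip _), ?_⟩
    simp only [sz, Enc.enc, encList, Data.size] at hmT ⊢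
    omega
  | cons a l =>
    have hs : RunsIn .snd (Enc.enc (x, b, a :: l)) (Enc.enc (b, a :: l)) _ := .snd _ _
    have hss := hs.seq (.snd (Enc.enc b) (Enc.enc (a :: l)))
    obtain ⟨m, hm, hmT⟩ := hss
    have hx : RunsIn .fst (Enc.enc (x, b, a :: l)) (Enc.enc x) _ := .fst _ _
    have hb := hs.seq (.fst (Enc.enc b) (Enc.enc (a :: l)))
    have ha := hs.seq ((RunsIn.snd (Enc.enc b) (Enc.enc (a :: l))).seq
      (.fst (Enc.enc a) (Enc.enc l)))
    have hr := hs.seq ((RunsIn.snd (Enc.enc b) (Enc.enc (a :: l))).seq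
      (.snd (Enc.enc a) (Enc.enc l)))
    obtain ⟨n, hn, hnT⟩ := hx.pair (((hx.pair (hb.pair ha)).seq (hp (x, b, a))).pair hr)
    have hF : F.eval (sz (x, b, a)) ≤ F.eval (sz (x, b, a :: l)) :=
      eval_mono F (by simp only [sz_prod, sz_cons]; omega)
    refine ⟨_, .ite_true hm hn, ?_⟩
    simp only [sz, Enc.enc, encList, Data.size] at hmT hnT hF ⊢
    omega

/-- Left folds whose steps increase the size by a polynomial amount. -/
theorem PolyTime.foldl {l : ξ → List α} {init : ξ → β} {f : ξ → β → α → β} (hl : PolyTime l)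
    (hinit : PolyTime init) (hf : PolyTime fun p : ξ × β × α => f p.1 p.2.1 p.2.2) {g : ξ → ℕ}
    (hg : PolyBounded g) (hgrow : ∀ x b, ∀ a ∈ l x, sz (f x b a) ≤ sz b + g x) :
    PolyTime fun x => (l x).foldl (f x) (init x) := by
  have hlen : PolyBounded fun x => (l x).length := hl.polyBounded.mono fun x => length_le_sz _
  have key : PolyTime fun x => (DataExchange.foldStep f)^[(l x).length] (x, init x, l x) := by
    refine PolyTime.iterate (PolyTime.id.pair (hinit.pair hl)) (.foldStep hf)
      (T := fun s => ¬ s.2.2 = []) (PolyTest.eq_nil PolyTime.id.snd.snd).not hlen ?_ ?_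
      (S := fun x => sz x + (sz (init x) + (l x).length * g x) + sz (l x) + 2) ?_ ?_
    · intro x i hi
      simp only [foldStep_iterate, List.drop_eq_nil_iff]
      omega
    · intro x
      simp [foldStep_iterate]
    · exact (((PolyBounded.sz).add (hinit.polyBounded.add (hlen.mul hg))).add
        hl.polyBounded).add (.const 2)
    · intro x i hi
      simp only [foldStep_iterate, sz_prod]
      -- Additive growth is essential: it accumulates linearly along the list, whereas a merely
      -- polynomial bound per step could compound exponentially.
      have h1 : ∀ (s : List α) b, (∀ a ∈ s, a ∈ l x) →
          sz (s.foldl (f x) b) ≤ sz b + s.length * g x := by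
        intro s
        induction s with
        | nil => simp
        | cons a s ih =>
          intro b hs
          have h2 := ih (f x b a) fun a ha => hs a (by simp [ha])
          have h3 := hgrow x b a (hs a (by simp))
          rw [List.foldl_cons, List.length_cons, Nat.succ_mul]
          omega
      have h2 := h1 ((l x).take i) (init x) fun a ha => List.mem_of_mem_take ha
      have h3 := sz_sublist (List.drop_sublist i (l x))
      have h4 : ((l x).take i).length * g x ≤ (l x).length * g x :=
        Nat.mul_le_mul_right _ (List.length_take_le' _ _)
      omega
  exact key.snd.fst.congr fun x => by simp [foldStep_iterate]

/-! ### Lists -/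

theorem PolyTime.cons {f : ξ → α} {l : ξ → List α} (hf : PolyTime f) (hl : PolyTime l) :
    PolyTime fun x => f x :: l x :=
  (hf.pair hl).of_enc_eq fun _ => rfl

theorem PolyTime.tail {l : ξ → List α} (hl : PolyTime l) : PolyTime fun x => (l x).tail :=
  hl.of_enc.right.of_enc_eq fun x => by cases l x <;> rfl

theorem PolyTime.headD {l : ξ → List α} (hl : PolyTime l) (d : α) :
    PolyTime fun x => (l x).headD d := by
  classical
  refine (PolyTime.ite (PolyTest.eq_nil hl) (.const (Enc.enc d)) hl.of_enc.left).of_enc_eq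
    fun x => ?_
  cases h : l x with
  | nil => simp; rfl
  | cons a l => simp; rfl

theorem PolyTime.getD {l : ξ → List α} (hl : PolyTime l) (i : ℕ) (d : α) :
    PolyTime fun x => (l x).getD i d := by
  induction i generalizing l with
  | zero => exact (hl.headD d).congr fun x => by cases l x <;> simp
  | succ i ih => exact (ih hl.tail).congr fun x => by cases l x <;> simp

theorem PolyTime.list_fixed {ι : Type} (s : List ι) {f : ι → ξ → α}
    (h : ∀ i ∈ s, PolyTime (f i)) : PolyTime fun x => s.map fun i => f i x := by
  induction s with
  | nil => exact .const []
  | cons i s ih => exact (h i (by simp)).cons (ih fun j hj => h j (by simp [hj]))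

theorem PolyTime.reverse {l : ξ → List α} (hl : PolyTime l) :
    PolyTime fun x => (l x).reverse := by
  refine (PolyTime.foldl (f := fun _ b a => a :: b) hl (.const []) (PolyTime.id.snd.snd.cons
    PolyTime.id.snd.fst) hl.polyBounded fun x b a ha => ?_).congr fun x => ?_
  · rw [sz_cons]
    have := sz_le_of_mem ha
    omega
  · simp

theorem PolyTime.append {l l' : ξ → List α} (hl : PolyTime l) (hl' : PolyTime l') :
    PolyTime fun x => l x ++ l' x := by
  refine (PolyTime.foldl (f := fun _ b a => a :: b) hl.reverse hl' (PolyTime.id.snd.snd.cons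
    PolyTime.id.snd.fst) hl.polyBounded fun x b a ha => ?_).congr fun x => ?_
  · rw [sz_cons]
    have := sz_le_of_mem (List.mem_reverse.1 ha)
    omega
  · simp

/-- Elements are smaller than the list that contains them, so a bound in terms of `(x, a)` becomes
uniform in `a`. -/
theorem PolyBounded.of_mem {l : ξ → List α} (hl : PolyTime l) {t : ξ × α → ℕ}
    (ht : PolyBounded t) : ∃ g : ξ → ℕ, PolyBounded g ∧ ∀ x, ∀ a ∈ l x, t (x, a) ≤ g x := by
  obtain ⟨P, hP⟩ := ht
  refine ⟨_, (PolyBounded.sz.add hl.polyBounded).eval P, fun x a ha => (hP _).trans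
    (eval_mono P ?_)⟩
  have := sz_le_of_mem ha
  rw [sz_prod]
  omega

theorem PolyTime.map {l : ξ → List α} {f : ξ → α → β} (hl : PolyTime l)
    (hf : PolyTime fun p : ξ × α => f p.1 p.2) : PolyTime fun x => (l x).map (f x) := by
  obtain ⟨g, hg, hfg⟩ := PolyBounded.of_mem hl hf.polyBounded
  refine (PolyTime.foldl (f := fun x b a => f x a :: b) hl.reverse (.const []) ((PolyTime.comp₂ hf
    PolyTime.id.fst PolyTime.id.snd.snd).cons PolyTime.id.snd.fst)
    (hg.add (.const 1)) fun x b a ha => ?_).congr fun x => ?_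
  · have : sz (f x a) ≤ g x := hfg x a (List.mem_reverse.1 ha)
    rw [sz_cons]
    omega
  · rw [List.foldl_reverse, List.foldr_cons_eq_append, List.append_nil]

theorem PolyTime.flatMap {l : ξ → List α} {f : ξ → α → List β} (hl : PolyTime l)
    (hf : PolyTime fun p : ξ × α => f p.1 p.2) : PolyTime fun x => (l x).flatMap (f x) := by
  obtain ⟨g, hg, hfg⟩ := PolyBounded.of_mem hl hf.polyBounded
  refine (PolyTime.foldl (f := fun x b a => f x a ++ b) hl.reverse (.const []) ((PolyTime.comp₂ hf
    PolyTime.id.fst PolyTime.id.snd.snd).append PolyTime.id.snd.fst)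
    hg fun x b a ha => ?_).congr fun x => ?_
  · have : sz (f x a) ≤ g x := hfg x a (List.mem_reverse.1 ha)
    have := sz_append (f x a) b
    omega
  · rw [List.foldl_reverse]
    induction l x with
    | nil => rfl
    | cons a s ih => simp [ih]

theorem PolyTime.flatMap_fixed {ι : Type} (s : List ι) {f : ι → ξ → List α}
    (h : ∀ i ∈ s, PolyTime (f i)) : PolyTime fun x => s.flatMap fun i => f i x := by
  induction s with
  | nil => exact .const []
  | cons i s ih => exact (h i (by simp)).append (ih fun j hj => h j (by simp [hj]))

theorem PolyTime.filter {l : ξ → List α} {P : ξ → α → Prop} [∀ x, DecidablePred (P x)]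
    (hl : PolyTime l) (hP : PolyTest fun p : ξ × α => P p.1 p.2) :
    PolyTime fun x => (l x).filter fun a => P x a := by
  classical
  refine (PolyTime.flatMap (f := fun x a => if P x a then [a] else []) hl
    (PolyTime.ite hP (PolyTime.id.snd.cons (.const [])) (.const []))).congr fun x => ?_
  induction l x with
  | nil => rfl
  | cons a s ih => by_cases h : P x a <;> simp [h, ih]

theorem PolyTest.bex {l : ξ → List α} {P : ξ → α → Prop} (hl : PolyTime l)
    (hP : PolyTest fun p : ξ × α => P p.1 p.2) : PolyTest fun x => ∃ a ∈ l x, P x a := by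
  classical
  exact (PolyTest.eq_nil (PolyTime.filter hl hP)).not.congr fun x => by
    simp [List.filter_eq_nil_iff]

theorem PolyTest.mem (hinj : Function.Injective (Enc.enc : α → Data)) {f : ξ → α}
    {l : ξ → List α} (hf : PolyTime f) (hl : PolyTime l) : PolyTest fun x => f x ∈ l x :=
  (PolyTest.bex (P := fun x a => f x = a) hl (.eq hinj (hf.comp PolyTime.id.fst)
    PolyTime.id.snd)).congr fun x => by simp

/-- All lists of length `n` over `V`. -/
def tuples {α : Type} (V : List α) : ℕ → List (List α)
  | 0 => [[]]
  | n + 1 => V.flatMap fun v => (tuples V n).map fun e => v :: e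

theorem mem_tuples {α : Type} {V : List α} {n : ℕ} {e : List α} :
    e ∈ tuples V n ↔ e.length = n ∧ ∀ v ∈ e, v ∈ V := by
  induction n generalizing e with
  | zero => cases e <;> simp [tuples]
  | succ n ih =>
    cases e with
    | nil => simp [tuples]
    | cons a e => simp [tuples, ih]; tauto

/-- The length `n` is fixed, so the recursion is unfolded into the program and the number of tuples
is a polynomial of degree `n` in the length of `V`. -/
theorem PolyTime.tuples {V : ξ → List α} (hV : PolyTime V) (n : ℕ) :
    PolyTime fun x => tuples (V x) n := by
  induction n with
  | zero => exact .const [[]]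
  | succ n ih =>
    exact PolyTime.flatMap hV (PolyTime.map (f := fun (p : ξ × α) e => p.2 :: e)
      (ih.comp PolyTime.id.fst) (PolyTime.id.fst.snd.cons PolyTime.id.snd))

end

/-! ### Injectivity of encodings -/

theorem encList_injective {α : Type} {e : α → Data} (he : Function.Injective e) :
    Function.Injective (encList e) := by
  intro l l' h
  induction l generalizing l' with
  | nil => cases l' <;> simp_all [encList]
  | cons a l ih =>
    cases l' with
    | nil => simp [encList] at h
    | cons b l' =>
      simp only [encList, Data.node.injEq] at h
      rw [he h.1, ih h.2]

theorem encBool_injective : Function.Injective encBool := by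
  intro a b h
  cases a <;> cases b <;> simp_all [encBool]

theorem encString_injective : Function.Injective encString := encList_injective encBool_injective

theorem encVal_injective : Function.Injective encVal := by
  intro a b h
  cases a <;> cases b <;> simp_all [encVal, encString_injective.eq_iff]

theorem encTag_injective : Function.Injective encTag := by
  intro m n h
  induction m generalizing n with
  | zero => cases n <;> simp_all [encTag]
  | succ m ih =>
    cases n with
    | zero => simp [encTag] at h
    | succ n => simp only [encTag, Data.node.injEq, true_and] at h; rw [ih h]

/-- The arguments of a fact as a list. -/
def Atom.argList {τ : Type} (a : Atom τ) : List τ := List.ofFn a.args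

theorem Atom.ext_argList {τ : Type} {a b : Atom τ} (hn : a.rel.name = b.rel.name)
    (h : a.argList = b.argList) : a = b := by
  obtain ⟨⟨n, k⟩, f⟩ := a
  obtain ⟨⟨n', k'⟩, f'⟩ := b
  have hk : k = k' := by simpa [argList] using congrArg List.length h
  subst hk
  obtain rfl : n = n' := hn
  obtain rfl : f = f' := List.ofFn_injective h
  rfl

theorem Atom.argList_map {τ τ' : Type} (f : τ → τ') (a : Atom τ) :
    (a.map f).argList = a.argList.map f := by
  simp [argList, Atom.map, List.map_ofFn, Function.comp_def]

theorem Atom.mem_argList {τ : Type} {a : Atom τ} {t : τ} : t ∈ a.argList ↔ ∃ i, a.args i = t := by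
  simp [argList]

theorem encFact_injective : Function.Injective encFact := by
  intro a b h
  simp only [encFact, Data.node.injEq] at h
  exact Atom.ext_argList (encString_injective h.1) (encList_injective encVal_injective h.2)

/-! ### Three-valued logic -/

instance : Enc SignType where
  enc
    | .zero => encTag 1
    | .neg => encTag 0
    | .pos => encTag 2

theorem encSign_injective : Function.Injective (Enc.enc : SignType → Data) := by
  intro a b h
  cases a <;> cases b <;> simp_all [Enc.enc, encTag_injective.eq_iff]

theorem sz_sign_le (s : SignType) : sz s ≤ 5 := by cases s <;> decide

/-- The three-valued value of a disjunction. -/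
def supList (l : List SignType) : SignType := l.foldr max (-1)

/-- The three-valued value of a conjunction. -/
def infList (l : List SignType) : SignType := l.foldr min 1

section
variable {ξ : Type} [Enc ξ]

theorem PolyTest.eq_sign {f : ξ → SignType} (hf : PolyTime f) (s : SignType) :
    PolyTest fun x => f x = s :=
  PolyTest.eq encSign_injective hf (.const s)

/-- Functions on three-valued truth values are given by tables. -/
theorem PolyTime.sign₂ (h : SignType → SignType → SignType) {f g : ξ → SignType}
    (hf : PolyTime f) (hg : PolyTime g) : PolyTime fun x => h (f x) (g x) := by
  have h1 : ∀ s, PolyTime fun x => h s (g x) := fun s =>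
    (PolyTime.ite (PolyTest.eq_sign hg 1) (.const (h s 1))
      (.ite (PolyTest.eq_sign hg 0) (.const (h s 0)) (.const (h s (-1))))).congr fun x => by
        generalize g x = t
        cases t <;> rfl
  exact (PolyTime.ite (PolyTest.eq_sign hf 1) (h1 1)
    (.ite (PolyTest.eq_sign hf 0) (h1 0) (h1 (-1)))).congr fun x => by
      generalize f x = t
      cases t <;> rfl

theorem PolyTime.min {f g : ξ → SignType} (hf : PolyTime f) (hg : PolyTime g) :
    PolyTime fun x => min (f x) (g x) := PolyTime.sign₂ Min.min hf hg

theorem PolyTime.max {f g : ξ → SignType} (hf : PolyTime f) (hg : PolyTime g) :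
    PolyTime fun x => max (f x) (g x) := PolyTime.sign₂ Max.max hf hg

theorem PolyTime.neg {f : ξ → SignType} (hf : PolyTime f) : PolyTime fun x => -f x :=
  PolyTime.sign₂ (fun s _ => -s) hf hf

theorem PolyTime.foldr_sign (h : SignType → SignType → SignType) (s : SignType)
    {l : ξ → List SignType} (hl : PolyTime l) : PolyTime fun x => (l x).foldr h s :=
  (PolyTime.foldl (f := fun _ b a => h a b) hl.reverse (.const s)
    (PolyTime.sign₂ h PolyTime.id.snd.snd PolyTime.id.snd.fst) (.const 5) fun _ b a _ =>
      (sz_sign_le _).trans (by omega)).congr fun x => by simp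

theorem PolyTime.supList {l : ξ → List SignType} (hl : PolyTime l) :
    PolyTime fun x => supList (l x) := PolyTime.foldr_sign _ _ hl

theorem PolyTime.infList {l : ξ → List SignType} (hl : PolyTime l) :
    PolyTime fun x => infList (l x) := PolyTime.foldr_sign _ _ hl

theorem PolyTime.fact_name {f : ξ → DBFact} (hf : PolyTime f) :
    PolyTime fun x => (f x).rel.name :=
  hf.of_enc.left.of_enc_eq fun _ => rfl

theorem PolyTime.argList {f : ξ → DBFact} (hf : PolyTime f) : PolyTime fun x => (f x).argList :=
  hf.of_enc.right.of_enc_eq fun _ => rfl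

end

open Classical in
/-- The three-valued value of an equality, on the level of encodings. -/
noncomputable def evalEqData (t u : Data) : SignType :=
  if t = u then 1 else if t.left = .leaf ∧ u.left = .leaf then -1 else 0

theorem evalEqData_enc (t u : Val) : evalEqData (encVal t) (encVal u) = evalEq t u := by
  simp only [evalEqData, encVal_injective.eq_iff, evalEq]
  cases t <;> cases u <;> simp [encVal, Data.left]

section
variable {ξ : Type} [Enc ξ]

theorem PolyTime.evalEqData {f g : ξ → Data} (hf : PolyTime f) (hg : PolyTime g) :
    PolyTime fun x => evalEqData (f x) (g x) := by
  classical
  exact PolyTime.ite (.eq_data hf hg) (.const 1) (.ite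
    ((PolyTest.eq_data hf.left (.const .leaf)).and (.eq_data hg.left (.const .leaf)))
    (.const (-1)) (.const 0))

theorem PolyTime.evalEq {f g : ξ → Val} (hf : PolyTime f) (hg : PolyTime g) :
    PolyTime fun x => evalEq (f x) (g x) :=
  (PolyTime.evalEqData hf.of_enc hg.of_enc).congr fun _ => (evalEqData_enc _ _).symm

end

/-! ### Evaluation of conditions by a stack machine

The state consists of a list of tasks and a list of values. A task is the encoding of a condition,
or one of the operations *negation*, *minimum*, *maximum*, which have tags of their own. -/

/-- The encoding of an operation of the stack machine. -/
def opData (k : ℕ) : Data := .node (encTag (7 + k)) .leaf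

open Classical in
/-- One step of the machine with first task `d`, remaining tasks `w` and values `v`. -/
noncomputable def evalTask (d : Data) (w : List Data) (v : List SignType) :
    List Data × List SignType :=
  if d.left = encTag 0 then (w, 1 :: v)
  else if d.left = encTag 1 then (w, -1 :: v)
  else if d.left = encTag 2 then (w, evalEqData d.right.left d.right.right :: v)
  else if d.left = encTag 3 then (d.right :: opData 0 :: w, v)
  else if d.left = encTag 4 then (d.right.left :: d.right.right :: opData 1 :: w, v)
  else if d.left = encTag 5 then (d.right.left :: d.right.right :: opData 2 :: w, v)
  -- An implication is the maximum of the negated premise and the conclusion; the negation is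
  -- scheduled directly after the premise.
  else if d.left = encTag 6 then
    (d.right.left :: opData 0 :: d.right.right :: opData 2 :: w, v)
  else if d.left = encTag 7 then (w, -v.headD 0 :: v.tail)
  else if d.left = encTag 8 then (w, min (v.headD 0) (v.tail.headD 0) :: v.tail.tail)
  else (w, max (v.headD 0) (v.tail.headD 0) :: v.tail.tail)

open Classical in
/-- One step of the machine, which stops when there are no tasks. -/
noncomputable def evalStep (s : List Data × List SignType) : List Data × List SignType :=
  if s.1 = [] then s else evalTask (s.1.headD .leaf) s.1.tail s.2

/-- The number of steps that the evaluation of a condition takes. -/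
def Condition.steps : Condition → ℕ
  | .tru => 1
  | .fls => 1
  | .eq _ _ => 1
  | .neg φ => φ.steps + 2
  | .and φ ψ => φ.steps + ψ.steps + 2
  | .or φ ψ => φ.steps + ψ.steps + 2
  | .imp φ ψ => φ.steps + ψ.steps + 3

theorem Condition.steps_le (φ : Condition) : φ.steps ≤ sz φ := by
  induction φ <;> simp only [steps, sz, Enc.enc, encCond, encTag, Data.size] at * <;> omega

theorem evalStep_cons (d : Data) (w : List Data) (v : List SignType) :
    evalStep (d :: w, v) = evalTask d w v := by simp [evalStep]

/-- Leaving the remaining tasks and values arbitrary lets the induction hypotheses be chained.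
Operands are popped in reverse order, which is harmless because minimum and maximum commute. -/
theorem evalStep_iterate (φ : Condition) (w : List Data) (v : List SignType) :
    evalStep^[φ.steps] (encCond φ :: w, v) = (w, φ.eval :: v) := by
  induction φ generalizing w v with
  | neg φ ih =>
    rw [show (Condition.neg φ).steps = 1 + (φ.steps + 1) by simp [Condition.steps]; omega]
    simp only [Function.iterate_add_apply, Function.iterate_one]
    simp [evalStep_cons, evalTask, encCond, Data.left, Data.right, Condition.eval,
      encTag_injective.eq_iff, ih, opData]
  | and φ ψ ih₁ ih₂ =>
    rw [show (Condition.and φ ψ).steps = 1 + (ψ.steps + (φ.steps + 1)) by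
      simp [Condition.steps]; omega]
    simp only [Function.iterate_add_apply, Function.iterate_one]
    simp [evalStep_cons, evalTask, encCond, Data.left, Data.right, Condition.eval,
      encTag_injective.eq_iff, ih₁, ih₂, opData, min_comm]
  | or φ ψ ih₁ ih₂ =>
    rw [show (Condition.or φ ψ).steps = 1 + (ψ.steps + (φ.steps + 1)) by
      simp [Condition.steps]; omega]
    simp only [Function.iterate_add_apply, Function.iterate_one]
    simp [evalStep_cons, evalTask, encCond, Data.left, Data.right, Condition.eval,
      encTag_injective.eq_iff, ih₁, ih₂, opData, max_comm]
  | imp φ ψ ih₁ ih₂ =>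
    rw [show (Condition.imp φ ψ).steps = 1 + (ψ.steps + (1 + (φ.steps + 1))) by
      simp [Condition.steps]; omega]
    simp only [Function.iterate_add_apply, Function.iterate_one]
    simp [evalStep_cons, evalTask, encCond, Data.left, Data.right, Condition.eval,
      encTag_injective.eq_iff, ih₁, ih₂, opData, max_comm]
  | _ =>
    simp [Condition.steps, evalStep, evalTask, encCond, Data.left, Data.right, Condition.eval,
      encTag_injective.eq_iff, evalEqData_enc]

/-- A step replaces the first task by its immediate parts and adds at most two operations, of size
at most 21 each, or one truth value, of size at most 5. No subcondition is copied. -/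
theorem sz_evalStep_le (s : List Data × List SignType) : sz (evalStep s) ≤ sz s + 50 := by
  obtain ⟨w, v⟩ := s
  cases w with
  | nil => simp [evalStep]
  | cons d w =>
    have hv : sz v.tail ≤ sz v := sz_sublist (List.tail_sublist v)
    have hvv : sz v.tail.tail ≤ sz v.tail := sz_sublist (List.tail_sublist v.tail)
    have hd := sz_pos d
    have ho : ∀ k < 3, sz (opData k) ≤ 21 := by decide
    have h0 := ho 0 (by omega)
    have h1 := ho 1 (by omega)
    have h2 := ho 2 (by omega)
    have hr : ∀ e : Data, sz e.right ≤ sz e ∧ (e ≠ .leaf → sz e.left + sz e.right < sz e) := by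
      intro e
      cases e <;> simp [sz, Enc.enc, Data.left, Data.right, Data.size]; omega
    have hd1 := (hr d).1
    have hs := fun s => sz_sign_le s
    have hl : sz d.right.left + sz d.right.right ≤ sz d.right + 1 := by
      cases h : d.right with
      | leaf => decide
      | node a b => have := (hr d.right).2 (by simp [h]); rw [h] at this; omega
    rw [evalStep_cons, evalTask]
    split_ifs <;> simp only [sz_prod, sz_cons]
    · have := hs 1; omega
    · have := hs (-1); omega
    · have := hs (evalEqData d.right.left d.right.right); omega
    · omega
    · omega
    · omega
    · omega
    · have := hs (-v.headD 0); omega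
    · have := hs (min (v.headD 0) (v.tail.headD 0)); omega
    · have := hs (max (v.headD 0) (v.tail.headD 0)); omega

section
variable {α β ξ : Type} [Enc α] [Enc β] [Enc ξ]

theorem PolyTime.evalStep : PolyTime evalStep := by
  have hd : PolyTime fun s : List Data × List SignType => s.1.headD .leaf := PolyTime.id.fst.headD _
  have hw := (PolyTime.id (α := List Data × List SignType)).fst.tail
  have hv := (PolyTime.id (α := List Data × List SignType)).snd
  have ht : ∀ k, PolyTest fun s : List Data × List SignType =>
      (s.1.headD .leaf).left = encTag k := fun k => .eq_data hd.left (.const _)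
  have op : ∀ k, PolyTime fun _ : List Data × List SignType => opData k := fun k => .const _
  classical
  refine PolyTime.ite (.eq_nil PolyTime.id.fst) .id ?_
  refine PolyTime.ite (ht 0) (hw.pair ((PolyTime.const 1).cons hv)) ?_
  refine PolyTime.ite (ht 1) (hw.pair ((PolyTime.const (-1)).cons hv)) ?_
  refine PolyTime.ite (ht 2) (hw.pair ((hd.right.left.evalEqData hd.right.right).cons hv)) ?_
  refine PolyTime.ite (ht 3) ((hd.right.cons ((op 0).cons hw)).pair hv) ?_
  refine PolyTime.ite (ht 4) ((hd.right.left.cons (hd.right.right.cons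
    ((op 1).cons hw))).pair hv) ?_
  refine PolyTime.ite (ht 5) ((hd.right.left.cons (hd.right.right.cons
    ((op 2).cons hw))).pair hv) ?_
  refine PolyTime.ite (ht 6) ((hd.right.left.cons ((op 0).cons (hd.right.right.cons
    ((op 2).cons hw)))).pair hv) ?_
  refine PolyTime.ite (ht 7) (hw.pair ((hv.headD 0).neg.cons hv.tail)) ?_
  exact PolyTime.ite (ht 8) (hw.pair (((hv.headD 0).min (hv.tail.headD 0)).cons hv.tail.tail))
    (hw.pair (((hv.headD 0).max (hv.tail.headD 0)).cons hv.tail.tail))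

/-- Iteration of a step until a fixed point, when every step increases the size by a constant. -/
theorem PolyTime.iterate_until {init : ξ → β} {step : β → β} {T : β → Prop} {N : ξ → ℕ} {C : ℕ}
    (hinit : PolyTime init) (hstep : PolyTime step) (hT : PolyTest T) (hN : PolyBounded N)
    (hfix : ∀ s, ¬ T s → step s = s) (hfalse : ∀ x, ¬ T (step^[N x] (init x)))
    (hgrow : ∀ s, sz (step s) ≤ sz s + C) :
    PolyTime fun x => step^[N x] (init x) := by
  classical
  -- `PolyTime.iterate` needs the test to succeed up to the last round, so the loop is run to the
  -- first failure; from there on the state is fixed and the `N x`-th iterate is the same.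
  have hex : ∀ x, ∃ n, ¬ T (step^[n] (init x)) := fun x => ⟨_, hfalse x⟩
  have hle : ∀ x, Nat.find (hex x) ≤ N x := fun x => Nat.find_min' _ (hfalse x)
  have hsz : ∀ x i, sz (step^[i] (init x)) ≤ sz (init x) + i * C := by
    intro x i
    induction i with
    | zero => simp
    | succ i ih =>
      rw [Function.iterate_succ_apply', Nat.succ_mul]
      have := hgrow (step^[i] (init x))
      omega
  refine (PolyTime.iterate (N := fun x => Nat.find (hex x)) hinit hstep hT (hN.mono hle)
    (fun x i hi => not_not.1 (Nat.find_min (hex x) hi)) (fun x => Nat.find_spec (hex x))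
    (S := fun x => sz (init x) + N x * C) (hinit.polyBounded.add (hN.mul (.const C)))
    fun x i hi => (hsz x i).trans ?_).congr fun x => ?_
  · have : i * C ≤ N x * C := Nat.mul_le_mul_right _ (hi.trans (hle x))
    omega
  · rw [← Nat.sub_add_cancel (hle x), Function.iterate_add_apply]
    exact Function.iterate_fixed (hfix _ (Nat.find_spec (hex x))) _

theorem PolyTime.condition_eval {f : ξ → Condition} (hf : PolyTime f) :
    PolyTime fun x => (f x).eval := by
  refine PolyTime.comp (g := Condition.eval) ?_ hf
  refine (((PolyTime.iterate_until (C := 50) (N := Condition.steps)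
    (init := fun φ : Condition => ([encCond φ], ([] : List SignType)))
    (T := fun s => ¬ s.1 = []) ((PolyTime.id.of_enc.cons (.const [])).pair (.const []))
    PolyTime.evalStep (PolyTest.eq_nil PolyTime.id.fst).not
    (PolyBounded.sz.mono Condition.steps_le) ?_ ?_ sz_evalStep_le).snd).headD 0).congr ?_
  · intro s hs
    simp [DataExchange.evalStep, not_not.1 hs]
  · intro φ
    simp [evalStep_iterate]
  · intro φ
    simp [evalStep_iterate]

/-! ### Conditional evaluation of queries -/

theorem eval_disj (l : List Condition) :
    (Condition.disj l).eval = supList (l.map Condition.eval) := by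
  induction l with
  | nil => rfl
  | cons φ l ih => simp_all [Condition.disj, supList, Condition.eval]

theorem eval_conj (l : List Condition) :
    (Condition.conj l).eval = infList (l.map Condition.eval) := by
  induction l with
  | nil => rfl
  | cons φ l ih => simp_all [Condition.conj, infList, Condition.eval]

theorem PolyTime.term_inst {σ : ξ → Var → Val} (hσ : ∀ y, PolyTime fun x => σ x y) (t : Term) :
    PolyTime fun x => t.inst (σ x) := by
  cases t with
  | const c => exact .const _
  | var y => exact hσ y

theorem PolyTime.atom_inst {σ : ξ → Var → Val} (hσ : ∀ y, PolyTime fun x => σ x y)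
    (a : Atom Term) : PolyTime fun x => a.map (Term.inst (σ x)) := by
  refine ((PolyTime.const a.rel.name).pair (PolyTime.list_fixed a.argList
    (f := fun t x => t.inst (σ x)) fun t _ => PolyTime.term_inst hσ t)).of_enc_eq fun x => ?_
  have := Atom.argList_map (Term.inst (σ x)) a
  simp only [Atom.argList] at this
  simp only [Enc.enc, encFact, this]
  rfl

/-- The three-valued value of the condition under which an atom with arguments `s` equals an atom
of the same name with arguments `t`. -/
def matchList : List Val → List Val → SignType
  | [], [] => 1
  | [], _ :: _ => -1
  | _ :: _, [] => -1
  | u :: s, v :: t => min (evalEq u v) (matchList s t)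

theorem matchList_of_length_ne {s t : List Val} (h : s.length ≠ t.length) :
    matchList s t = -1 := by
  induction s generalizing t with
  | nil => cases t <;> simp_all [matchList]
  | cons u s ih =>
    cases t with
    | nil => rfl
    | cons v t =>
      rw [matchList, ih (by simpa using h)]
      generalize evalEq u v = r
      cases r <;> rfl

theorem matchList_of_length_eq {s t : List Val} (h : s.length = t.length) :
    matchList s t = infList ((List.zipWith Condition.eq s t).map Condition.eval) := by
  induction s generalizing t with
  | nil => cases t <;> simp_all [matchList, infList]
  | cons u s ih =>
    cases t with
    | nil => simp at h
    | cons v t =>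
      rw [matchList, ih (by simpa using h)]
      simp [infList, Condition.eval]

/-- Encoded facts carry the name of the relation but not its arity. Relations with one name and
different arities are still told apart, since `matchList` is false on lists of different lengths. -/
theorem eval_matchCond (a b : DBFact) : (matchCond a b).eval =
    if a.rel.name = b.rel.name then matchList a.argList b.argList else -1 := by
  obtain ⟨⟨n, k⟩, f⟩ := a
  obtain ⟨⟨n', k'⟩, f'⟩ := b
  simp only [matchCond, Atom.argList, RelSym.mk.injEq]
  by_cases hn : n = n'
  · by_cases hk : k = k'
    · rw [if_pos ⟨hn, hk⟩, if_pos hn, eval_conj, matchList_of_length_eq (by simpa using hk)]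
    · rw [if_neg (by tauto), if_pos hn, matchList_of_length_ne (by simpa using hk)]
      rfl
  · rw [if_neg (by tauto), if_neg hn]
    rfl

theorem PolyTime.matchList {ι : Type} (s : List ι) {f : ι → ξ → Val} (hf : ∀ i, PolyTime (f i))
    {t : ξ → List Val} (ht : PolyTime t) :
    PolyTime fun x => matchList (s.map fun i => f i x) (t x) := by
  classical
  induction s generalizing t with
  | nil =>
    refine (PolyTime.ite (.eq_nil ht) (.const 1) (.const (-1))).congr fun x => ?_
    cases t x <;> simp [DataExchange.matchList]
  | cons i s ih =>
    refine (PolyTime.ite (.eq_nil ht) (.const (-1))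
      (((hf i).evalEq (ht.headD (.const []))).min (ih ht.tail))).congr fun x => ?_
    cases t x <;> simp [DataExchange.matchList]

theorem PolyTime.eval_matchCond {σ : ξ → Var → Val} (hσ : ∀ y, PolyTime fun x => σ x y)
    (a : Atom Term) {b : ξ → DBFact} (hb : PolyTime b) :
    PolyTime fun x => (matchCond (a.map (Term.inst (σ x))) (b x)).eval := by
  classical
  refine (PolyTime.ite (P := fun x => a.rel.name = (b x).rel.name)
    (PolyTest.eq (encList_injective encBool_injective) (.const _)
    hb.fact_name) (PolyTime.matchList a.argList (f := fun t x => t.inst (σ x))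
      (PolyTime.term_inst hσ) hb.argList) (.const (-1))).congr fun x => ?_
  rw [DataExchange.eval_matchCond, Atom.argList_map]
  rfl

theorem PolyTime.terms {J : ξ → CInstance} (hJ : PolyTime J) : PolyTime fun x => (J x).terms :=
  PolyTime.flatMap (f := fun _ (p : CFact) => p.1.argList) hJ PolyTime.id.snd.fst.argList

theorem eval_domCond (J : CInstance) (d : Val) : (J.domCond d).eval =
    supList (J.flatMap fun p => p.1.argList.map fun u => min p.2.eval (evalEq u d)) := by
  simp only [CInstance.domCond, eval_disj, List.map_flatMap, List.map_map]
  rfl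

theorem PolyTime.eval_domCond {J : ξ → CInstance} (hJ : PolyTime J) {d : ξ → Val}
    (hd : PolyTime d) : PolyTime fun x => ((J x).domCond (d x)).eval := by
  refine (PolyTime.supList (PolyTime.flatMap (f := fun x (p : CFact) =>
    p.1.argList.map fun u => Min.min p.2.eval (DataExchange.evalEq u (d x))) hJ (PolyTime.map
    (f := fun (q : ξ × CFact) u => Min.min q.2.2.eval (DataExchange.evalEq u (d q.1)))
    PolyTime.id.snd.fst.argList (PolyTime.min ?_ ?_)))).congr fun x => DataExchange.eval_domCond _ _
  · exact PolyTime.id.fst.snd.snd.condition_eval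
  · exact PolyTime.id.snd.evalEq (hd.comp PolyTime.id.fst.fst)

/-- The truth value is computed directly by recursion on the fixed formula, without writing the
condition down. An assignment is handled variable by variable; under a quantifier the context `ξ` is
enlarged by the value of the bound variable, hence the generalization over `ξ`. -/
theorem PolyTime.eval_condEval (φ : Formula) {J : ξ → CInstance} (hJ : PolyTime J)
    {σ : ξ → Var → Val} (hσ : ∀ y, PolyTime fun x => σ x y) :
    PolyTime fun x => ((J x).condEval φ (σ x)).eval := by
  classical
  have upd : ∀ {ξ : Type} [Enc ξ] {σ : ξ → Var → Val} (z : Var)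
      (_ : ∀ y, PolyTime fun x => σ x y) (y : Var),
      PolyTime fun p : ξ × Val => Function.update (σ p.1) z p.2 y := by
    intro ξ _ σ z hσ y
    by_cases h : y = z
    · subst h
      exact PolyTime.id.snd.congr fun p => by simp
    · exact ((hσ y).comp PolyTime.id.fst).congr fun p => by simp [h]
  induction φ generalizing ξ with
  | atom a =>
    refine (PolyTime.supList (PolyTime.map (f := fun x (p : CFact) =>
      Min.min p.2.eval (matchCond (a.map (Term.inst (σ x))) p.1).eval) hJ
      (PolyTime.min PolyTime.id.snd.snd.condition_eval (PolyTime.eval_matchCond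
        (fun y => (hσ y).comp PolyTime.id.fst) a PolyTime.id.snd.fst)))).congr fun x => ?_
    simp only [CInstance.condEval, eval_disj, List.map_map]
    rfl
  | eq s t => exact (PolyTime.term_inst hσ s).evalEq (PolyTime.term_inst hσ t)
  | neg φ ih => exact (ih hJ hσ).neg
  | and φ ψ ih₁ ih₂ => exact (ih₁ hJ hσ).min (ih₂ hJ hσ)
  | or φ ψ ih₁ ih₂ => exact (ih₁ hJ hσ).max (ih₂ hJ hσ)
  | ex z φ ih =>
    refine (PolyTime.supList (PolyTime.map (f := fun x d => Min.min ((J x).domCond d).eval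
      ((J x).condEval φ (Function.update (σ x) z d)).eval) hJ.terms
      ((PolyTime.eval_domCond (hJ.comp PolyTime.id.fst) PolyTime.id.snd).min
        (ih (hJ.comp PolyTime.id.fst) (upd z hσ))))).congr fun x => ?_
    simp only [CInstance.condEval, eval_disj, List.map_map]
    rfl
  | all z φ ih =>
    refine (PolyTime.infList (PolyTime.map (f := fun x d => Max.max (-((J x).domCond d).eval)
      ((J x).condEval φ (Function.update (σ x) z d)).eval) hJ.terms
      ((PolyTime.eval_domCond (hJ.comp PolyTime.id.fst) PolyTime.id.snd).neg.max
        (ih (hJ.comp PolyTime.id.fst) (upd z hσ))))).congr fun x => ?_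
    simp only [CInstance.condEval, eval_conj, List.map_map]
    rfl

end

/-! ### The value *true* -/

theorem supList_eq_one {l : List SignType} : supList l = 1 ↔ (1 : SignType) ∈ l := by
  induction l with
  | nil => simp [supList]
  | cons s l ih =>
    rw [List.mem_cons, ← ih]
    simp only [supList, List.foldr_cons]
    generalize List.foldr max (-1) l = r
    revert s r
    decide

theorem infList_eq_one {l : List SignType} : infList l = 1 ↔ ∀ s ∈ l, s = (1 : SignType) := by
  induction l with
  | nil => simp [infList]
  | cons s l ih =>
    rw [List.forall_mem_cons, ← ih]
    simp only [infList, List.foldr_cons]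
    generalize List.foldr min 1 l = r
    revert s r
    decide

theorem sign_min_eq_one {s t : SignType} : min s t = 1 ↔ s = 1 ∧ t = 1 := by
  revert s t; decide

theorem evalEq_eq_one {t u : Val} : evalEq t u = 1 ↔ t = u := by
  cases t <;> cases u <;> simp [evalEq]

theorem evalEq_eq_neg_one {t u : Val} (h : evalEq t u = -1) :
    ∃ c d, c ≠ d ∧ t = .const c ∧ u = .const d := by
  cases t <;> cases u <;> simp [evalEq] at h ⊢
  · rename_i c d
    rintro rfl
    simp at h
  · split_ifs at h

theorem eval_domCond_eq_one {J : CInstance} {d : Val} :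
    (J.domCond d).eval = 1 ↔ ∃ p ∈ J, p.2.eval = 1 ∧ d ∈ p.1.argList := by
  rw [eval_domCond, supList_eq_one]
  simp only [List.mem_flatMap, List.mem_map]
  constructor
  · rintro ⟨p, hp, u, hu, h⟩
    rw [sign_min_eq_one, evalEq_eq_one] at h
    exact ⟨p, hp, h.1, h.2 ▸ hu⟩
  · rintro ⟨p, hp, h, hd⟩
    exact ⟨p, hp, d, hd, by rw [h, evalEq_eq_one.2 rfl]; rfl⟩

theorem CInstance.mem_terms {J : CInstance} {d : Val} :
    d ∈ J.terms ↔ ∃ p ∈ J, d ∈ p.1.argList := by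
  simp [terms, Atom.argList]

/-! ### Computing the approximate answers -/

theorem Term.inst_congr {σ τ : Var → Val} {t : Term} (h : ∀ x ∈ t.vars, σ x = τ x) :
    t.inst σ = t.inst τ := by
  cases t with
  | const c => rfl
  | var x => exact h x rfl

theorem Atom.inst_congr {σ τ : Var → Val} {a : Atom Term}
    (h : ∀ i x, a.args i = .var x → σ x = τ x) : a.map (Term.inst σ) = a.map (Term.inst τ) := by
  simp only [Atom.map, Atom.mk.injEq, heq_eq_eq, true_and]
  funext i
  refine Term.inst_congr fun x hx => ?_
  cases e : a.args i with
  | const c => simp [e, Term.vars] at hx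
  | var y =>
    rw [e] at hx
    obtain rfl : x = y := hx
    exact h i x e

theorem CInstance.condEval_congr (J : CInstance) (φ : Formula) {σ τ : Var → Val}
    (h : ∀ x ∈ φ.freeVars, σ x = τ x) : J.condEval φ σ = J.condEval φ τ := by
  have upd : ∀ (x : Var) (s : Set Var) (σ τ : Var → Val) (d : Val),
      (∀ y ∈ s \ {x}, σ y = τ y) →
      ∀ y ∈ s, Function.update σ x d y = Function.update τ x d y := by
    intro x s σ τ d h y hy
    by_cases e : y = x
    · subst e; simp
    · simp [e, h y ⟨hy, e⟩]
  induction φ generalizing σ τ with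
  | atom a => simp only [condEval, Atom.inst_congr fun i x e => h x ⟨i, e⟩]
  | eq s t =>
    simp only [condEval, Term.inst_congr fun x hx => h x (.inl hx),
      Term.inst_congr fun x hx => h x (.inr hx)]
  | neg φ ih => simp only [condEval, ih h]
  | and φ ψ ih₁ ih₂ =>
    simp only [condEval, ih₁ fun x hx => h x (.inl hx), ih₂ fun x hx => h x (.inr hx)]
  | or φ ψ ih₁ ih₂ =>
    simp only [condEval, ih₁ fun x hx => h x (.inl hx), ih₂ fun x hx => h x (.inr hx)]
  | ex x φ ih =>
    simp only [condEval]
    congr 2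
    funext d
    rw [ih (upd x _ σ τ d h)]
  | all x φ ih =>
    simp only [condEval]
    congr 2
    funext d
    rw [ih (upd x _ σ τ d h)]

/-- The assignment given by a list of values. -/
def env (e : List Val) (x : Var) : Val := e.getD x (.const [])

theorem PolyTime.env {ξ : Type} [Enc ξ] {e : ξ → List Val} (he : PolyTime e) (y : Var) :
    PolyTime fun x => env (e x) y := he.getD y _

/-- An assignment with values in `V` is given, on the variables below `m` with values in `V`, by a
tuple over `V`. -/
theorem exists_tuple_env (m : ℕ) (V : List Val) (hV : Val.const [] ∈ V) (h : Var → Val) :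
    ∃ e ∈ tuples V m, ∀ x < m, h x ∈ V → env e x = h x := by
  classical
  refine ⟨(List.range m).map fun x => if h x ∈ V then h x else .const [],
    mem_tuples.2 ⟨by simp, fun v hv => ?_⟩, fun x hx hxV => ?_⟩
  · obtain ⟨x, -, rfl⟩ := List.mem_map.1 hv
    split_ifs with h
    exacts [h, hV]
  · simp [DataExchange.env, List.getD_eq_getElem?_getD, hx, hxV]

theorem env_mem {m : ℕ} {V : List Val} (hV : Val.const [] ∈ V) {e : List Val}
    (he : e ∈ tuples V m) (x : Var) : env e x ∈ V := by
  rw [DataExchange.env, List.getD_eq_getElem?_getD]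
  cases h : e[x]? with
  | none => exact hV
  | some v => exact (mem_tuples.1 he).2 v (List.mem_of_getElem? h)

open Classical in
/-- The approximate answers as a list; `m` bounds the answer variables. -/
noncomputable def Query.trueAnswersList (Q : Query) (m : ℕ) (J : CInstance) :
    List (Fin Q.arity → Val) :=
  ((tuples (.const [] :: J.terms) m).filter fun e =>
    (∀ i ∈ List.finRange Q.arity, (∃ c, env e (Q.head i) = .const c) ∧
      (J.domCond (env e (Q.head i))).eval = 1) ∧ (J.condEval Q.formula (env e)).eval = 1).map
    fun e i => env e (Q.head i)

theorem Query.mem_trueAnswersList (Q : Query) {m : ℕ} (hm : ∀ i, Q.head i < m) (J : CInstance)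
    (t : Fin Q.arity → Val) : t ∈ Q.trueAnswersList m J ↔ t ∈ Q.trueAnswers J := by
  simp only [trueAnswersList, trueAnswers, CInstance.condAnswers, List.mem_map, List.mem_filter,
    List.mem_finRange, true_imp_iff, decide_eq_true_eq, Set.mem_ofPred_eq]
  constructor
  · rintro ⟨e, ⟨he, h, hφ⟩, rfl⟩
    refine ⟨fun i => (h i).1, _, ⟨env e, fun i => ?_, fun i => rfl, rfl⟩, ?_⟩
    -- A true domain condition puts the value among the terms of `J`, so the padding constant in the
    -- tuples creates no spurious answers.
    · obtain ⟨p, hp, -, hd⟩ := eval_domCond_eq_one.1 (h i).2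
      exact CInstance.mem_terms.2 ⟨p, hp, hd⟩
    · simp only [Condition.eval, sign_min_eq_one, eval_conj, infList_eq_one, List.mem_map,
        List.mem_ofFn]
      exact ⟨fun s ⟨_, ⟨i, hi⟩, hs⟩ => by rw [← hs, ← hi]; exact (h i).2, hφ⟩
  · rintro ⟨hc, _, ⟨σ, hσ, ht, rfl⟩, h⟩
    simp only [Condition.eval, sign_min_eq_one, eval_conj, infList_eq_one, List.mem_map,
      List.mem_ofFn] at h
    -- The tuple need not agree with `σ` everywhere. It does on the answer variables, and these
    -- include all free variables of the formula.
    obtain ⟨e, he, hes⟩ := exists_tuple_env m (.const [] :: J.terms) (by simp) σ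
    have hei : ∀ i, env e (Q.head i) = σ (Q.head i) := fun i =>
      hes _ (hm i) (List.mem_cons_of_mem _ (hσ i))
    refine ⟨e, ⟨he, fun i => ?_, ?_⟩, funext fun i => by rw [hei, ht]⟩
    · rw [hei]
      exact ⟨ht i ▸ hc i, h.1 _ ⟨_, ⟨i, rfl⟩, rfl⟩⟩
    · rw [J.condEval_congr Q.formula (τ := σ)]
      · exact h.2
      · intro x hx
        obtain ⟨i, rfl⟩ := Q.freeVars_subset hx
        exact hei i

theorem Query.polyTime_trueAnswersList (Q : Query) (m : ℕ) :
    PolyTime (Q.trueAnswersList m) := by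
  classical
  have hJ : PolyTime fun p : CInstance × List Val => p.1 := PolyTime.id.fst
  have he : ∀ y, PolyTime fun p : CInstance × List Val => env p.2 y := PolyTime.id.snd.env
  have hc : ∀ y, PolyTest fun p : CInstance × List Val => ∃ c, env p.2 y = .const c := by
    intro y
    refine (PolyTest.eq_data (he y).of_enc.left (.const .leaf)).congr fun p => ?_
    cases env p.2 y <;> simp [Enc.enc, encVal, Data.left]
  refine PolyTime.map (f := fun (_ : CInstance) (e : List Val) (i : Fin Q.arity) =>
    env e (Q.head i)) (PolyTime.filter (P := fun (J : CInstance) e =>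
      (∀ i ∈ List.finRange Q.arity, (∃ c, env e (Q.head i) = .const c) ∧
      (J.domCond (env e (Q.head i))).eval = 1) ∧ (J.condEval Q.formula (env e)).eval = 1)
    (PolyTime.tuples ((PolyTime.const _).cons PolyTime.id.terms) m)
    ((PolyTest.ball_fixed (List.finRange Q.arity) (P := fun i (p : CInstance × List Val) =>
      (∃ c, env p.2 (Q.head i) = .const c) ∧ (p.1.domCond (env p.2 (Q.head i))).eval = 1)
      fun i _ => (hc _).and ?_).and ?_)) ?_
  · exact PolyTest.eq_sign (PolyTime.eval_domCond hJ (he _)) 1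
  · exact PolyTest.eq_sign (PolyTime.eval_condEval _ hJ he) 1
  · refine (PolyTime.list_fixed (List.finRange Q.arity) (f := fun i p => env p.2 (Q.head i))
      fun i _ => he _).of_enc_eq fun p => ?_
    simp only [Enc.enc, List.ofFn_eq_map]

/-! ### Soundness of the approximation -/

theorem Condition.sat_disj {ν : Null → Const} {l : List Condition} :
    (Condition.disj l).Sat ν ↔ ∃ φ ∈ l, φ.Sat ν := by
  induction l with
  | nil => simp [Condition.disj, Condition.Sat]
  | cons φ l ih => simp_all [Condition.disj, Condition.Sat]

theorem Condition.sat_conj {ν : Null → Const} {l : List Condition} :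
    (Condition.conj l).Sat ν ↔ ∀ φ ∈ l, φ.Sat ν := by
  induction l with
  | nil => simp [Condition.conj, Condition.Sat]
  | cons φ l ih => simp_all [Condition.conj, Condition.Sat]

/-- Truth and falsity are proved sound together, because negation and the premise of an implication
exchange them. -/
theorem Condition.sat_of_eval (ν : Null → Const) (φ : Condition) :
    (φ.eval = 1 → φ.Sat ν) ∧ (φ.eval = -1 → ¬ φ.Sat ν) := by
  have h1 : ∀ s t : SignType, (min s t = -1 ↔ s = -1 ∨ t = -1) ∧ (max s t = 1 ↔ s = 1 ∨ t = 1) ∧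
    (max s t = -1 ↔ s = -1 ∧ t = -1) ∧ (-s = 1 ↔ s = -1) ∧ (-s = -1 ↔ s = 1) := by decide
  induction φ with
  | tru => simp [Sat, eval]
  | fls => simp [Sat, eval]
  | eq t u =>
    refine ⟨fun h => ?_, fun h => ?_⟩
    · rw [evalEq_eq_one.1 h]; rfl
    · obtain ⟨c, d, hcd, rfl, rfl⟩ := evalEq_eq_neg_one h
      simpa [Sat, applyVal] using hcd
  | neg φ ih =>
    simp only [eval, Sat, (h1 _ φ.eval).2.2.2]
    tauto
  | and φ ψ ih₁ ih₂ =>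
    simp only [eval, Sat, sign_min_eq_one, (h1 φ.eval ψ.eval).1]
    tauto
  | or φ ψ ih₁ ih₂ =>
    simp only [eval, Sat, (h1 φ.eval ψ.eval).2.1, (h1 φ.eval ψ.eval).2.2.1]
    tauto
  | imp φ ψ ih₁ ih₂ =>
    simp only [eval, Sat, (h1 (-φ.eval) ψ.eval).2.1, (h1 (-φ.eval) ψ.eval).2.2.1,
      (h1 φ.eval ψ.eval).2.2.2]
    tauto

theorem Atom.map_map {τ τ' τ'' : Type} (f : τ → τ') (g : τ' → τ'') (a : Atom τ) :
    (a.map f).map g = a.map (g ∘ f) := rfl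

theorem applyVal_inst (ν : Null → Const) (σ : Var → Val) :
    applyVal ν ∘ Term.inst σ = Term.inst (applyVal ν ∘ σ) := by
  funext t
  cases t <;> rfl

theorem sat_matchCond {ν : Null → Const} {a b : DBFact} :
    (matchCond a b).Sat ν ↔ a.map (applyVal ν) = b.map (applyVal ν) := by
  have key : ∀ s t : List Val, s.length = t.length → ((∀ φ ∈ List.zipWith Condition.eq s t,
      φ.Sat ν) ↔ s.map (applyVal ν) = t.map (applyVal ν)) := by
    intro s
    induction s with
    | nil => intro t h; cases t <;> simp_all
    | cons u s ih =>
      intro t h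
      cases t with
      | nil => simp at h
      | cons v t => simp_all [Condition.Sat]
  rw [matchCond]
  split_ifs with h
  · rw [Condition.sat_conj, key _ _ (by simp [h])]
    constructor
    · intro e
      refine Atom.ext_argList (congrArg RelSym.name h) ?_
      rw [Atom.argList_map, Atom.argList_map]
      exact e
    · intro e
      have := congrArg Atom.argList e
      rwa [Atom.argList_map, Atom.argList_map] at this
  · refine ⟨False.elim, fun e => h ?_⟩
    exact (congrArg Atom.rel e : (a.map (applyVal ν)).rel = (b.map (applyVal ν)).rel)

theorem CInstance.sat_domCond {J : CInstance} {ν : Null → Const} {d : Val} :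
    (J.domCond d).Sat ν ↔ applyVal ν d ∈ adom (J.world ν) := by
  simp only [domCond, Condition.sat_disj, List.mem_flatMap, List.mem_map, List.mem_ofFn, adom,
    world, Set.mem_ofPred_eq]
  constructor
  · rintro ⟨_, ⟨p, hp, _, ⟨i, rfl⟩, rfl⟩, h⟩
    exact ⟨_, ⟨p, hp, h.1, rfl⟩, i, h.2⟩
  · rintro ⟨_, ⟨p, hp, h, rfl⟩, i, hi⟩
    exact ⟨_, ⟨p, hp, _, ⟨i, rfl⟩, rfl⟩, h, hi⟩

theorem CInstance.mem_adom_world {J : CInstance} {ν : Null → Const} {d : Val} :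
    d ∈ adom (J.world ν) ↔ ∃ u ∈ J.terms, (J.domCond u).Sat ν ∧ applyVal ν u = d := by
  constructor
  · intro h
    obtain ⟨_, ⟨p, hp, hs, rfl⟩, i, rfl⟩ := h
    exact ⟨p.1.args i, mem_terms.2 ⟨p, hp, Atom.mem_argList.2 ⟨i, rfl⟩⟩,
      sat_domCond.2 ⟨_, ⟨p, hp, hs, rfl⟩, i, rfl⟩, rfl⟩
  · rintro ⟨u, -, h, rfl⟩
    exact sat_domCond.1 h

/-- Conditional evaluation commutes with passing to a world. For quantifiers, the active domain of
the world consists of the images of those terms of `J` whose guard is satisfied. -/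
theorem CInstance.sat_condEval (J : CInstance) (ν : Null → Const) (φ : Formula) (σ : Var → Val) :
    (J.condEval φ σ).Sat ν ↔ φ.Holds (J.world ν) (applyVal ν ∘ σ) := by
  induction φ generalizing σ with
  | atom a =>
    simp only [condEval, Condition.sat_disj, List.mem_map, Formula.Holds, world, Set.mem_ofPred_eq,
      ← applyVal_inst, ← Atom.map_map]
    constructor
    · rintro ⟨_, ⟨p, hp, rfl⟩, h⟩
      exact ⟨p, hp, h.1, sat_matchCond.1 h.2⟩
    · rintro ⟨p, hp, h, e⟩
      exact ⟨_, ⟨p, hp, rfl⟩, h, sat_matchCond.2 e⟩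
  | eq s t =>
    simp only [condEval, Condition.Sat, Formula.Holds, ← applyVal_inst, Function.comp_apply]
  | neg φ ih => simp only [condEval, Condition.Sat, Formula.Holds, ih]
  | and φ ψ ih₁ ih₂ => simp only [condEval, Condition.Sat, Formula.Holds, ih₁, ih₂]
  | or φ ψ ih₁ ih₂ => simp only [condEval, Condition.Sat, Formula.Holds, ih₁, ih₂]
  | ex x φ ih =>
    simp only [condEval, Condition.sat_disj, List.mem_map, Formula.Holds]
    constructor
    · rintro ⟨_, ⟨u, hu, rfl⟩, h⟩
      refine ⟨applyVal ν u, sat_domCond.1 h.1, ?_⟩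
      rw [← Function.comp_update, ← ih]
      exact h.2
    · rintro ⟨d, hd, h⟩
      obtain ⟨u, hu, hs, rfl⟩ := mem_adom_world.1 hd
      refine ⟨_, ⟨u, hu, rfl⟩, hs, ?_⟩
      rwa [ih, Function.comp_update]
  | all x φ ih =>
    simp only [condEval, Condition.sat_conj, List.mem_map, Formula.Holds]
    constructor
    · intro h d hd
      obtain ⟨u, hu, hs, rfl⟩ := mem_adom_world.1 hd
      rw [← Function.comp_update, ← ih]
      exact h _ ⟨u, hu, rfl⟩ hs
    · rintro h _ ⟨u, hu, rfl⟩ hs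
      rw [ih, Function.comp_update]
      exact h _ (sat_domCond.1 hs)

/-- A condition with value true holds under every valuation, and valuations fix tuples of constants,
so the tuple is an answer in every world. -/
theorem Query.trueAnswers_subset_ccert (Q : Query) (J : CInstance) :
    Q.trueAnswers J ⊆ J.ccert Q := by
  rintro t ⟨hc, φ, ⟨σ, hσ, ht, rfl⟩, h⟩
  simp only [CInstance.ccert, Set.mem_iInter]
  rintro _ ⟨ν, rfl⟩
  have hs := (Condition.sat_of_eval ν _).1 h
  have hν : ∀ i, applyVal ν (t i) = t i := fun i => by
    obtain ⟨c, e⟩ := hc i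
    rw [e]; rfl
  refine ⟨fun i => ?_, applyVal ν ∘ σ, fun i => ?_, (J.sat_condEval ν _ _).1 hs.2⟩
  · have := Condition.sat_conj.1 hs.1 _ (List.mem_ofFn.2 ⟨i, rfl⟩)
    rwa [CInstance.sat_domCond, ← ht, hν] at this
  · rw [Function.comp_apply, ← ht, hν]

/-! ### Completeness for positive queries -/

/-- Formulas built from atoms by conjunction, disjunction and existential quantification. -/
def Formula.Pos : Formula → Prop
  | .atom _ => True
  | .and φ ψ => φ.Pos ∧ ψ.Pos
  | .or φ ψ => φ.Pos ∧ ψ.Pos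
  | .ex _ φ => φ.Pos
  | _ => False

theorem Formula.IsConj.pos {φ : Formula} (h : φ.IsConj) : φ.Pos := by
  induction φ with
  | atom a => trivial
  | and φ ψ ih₁ ih₂ => exact ⟨ih₁ h.1, ih₂ h.2⟩
  | _ => exact h.elim

theorem Formula.IsCQ.pos {φ : Formula} (h : φ.IsCQ) : φ.Pos := by
  induction φ with
  | atom a => trivial
  | and φ ψ => exact IsConj.pos h
  | ex x φ ih => exact ih h
  | _ => exact False.elim h

theorem Formula.IsUCQ.pos {φ : Formula} (h : φ.IsUCQ) : φ.Pos := by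
  induction φ with
  | atom a => trivial
  | and φ ψ => exact IsConj.pos h
  | ex x φ ih => exact IsCQ.pos h
  | or φ ψ ih₁ ih₂ => exact ⟨ih₁ h.1, ih₂ h.2⟩
  | _ => exact False.elim h

/-- The constants that occur in an atom. -/
def Atom.constSet (a : Atom Term) : Set Const := {c | ∃ i, a.args i = .const c}

/-- The mapping `g` may move constants: it will later send fresh constants back to nulls. It
commutes with instantiation as soon as it fixes the constants written in the atom. -/
theorem Atom.map_inst_comp {g : Val → Val} {a : Atom Term}
    (hg : ∀ c ∈ a.constSet, g (.const c) = .const c) (σ : Var → Val) :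
    (a.map (Term.inst σ)).map g = a.map (Term.inst (g ∘ σ)) := by
  simp only [Atom.map, Atom.mk.injEq, heq_eq_eq, true_and]
  funext i
  cases e : a.args i with
  | const c => exact hg c ⟨i, e⟩
  | var x => rfl

theorem Atom.finite_constSet (a : Atom Term) : a.constSet.Finite := by
  refine (Set.finite_range fun i => match a.args i with | .const c => c | .var _ => []).subset ?_
  rintro c ⟨i, hi⟩
  exact ⟨i, by simp [hi]⟩

/-- The constants that occur in the atoms of a formula. -/
def Formula.constSet : Formula → Set Const
  | .atom a => a.constSet
  | .eq _ _ => ∅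
  | .neg φ => φ.constSet
  | .and φ ψ => φ.constSet ∪ ψ.constSet
  | .or φ ψ => φ.constSet ∪ ψ.constSet
  | .ex _ φ => φ.constSet
  | .all _ φ => φ.constSet

theorem Formula.finite_constSet (φ : Formula) : φ.constSet.Finite := by
  induction φ with
  | atom a => exact a.finite_constSet
  | eq => exact Set.finite_empty
  | neg φ ih => exact ih
  | and φ ψ ih₁ ih₂ => exact ih₁.union ih₂
  | or φ ψ ih₁ ih₂ => exact ih₁.union ih₂
  | ex x φ ih => exact ih
  | all x φ ih => exact ih

theorem eval_domCond_of_hom {I : Instance} {J : CInstance} {g : Val → Val}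
    (hI : ∀ α ∈ I, (α.map g, Condition.tru) ∈ J) {d : Val} (hd : d ∈ adom I) :
    g d ∈ J.terms ∧ (J.domCond (g d)).eval = 1 := by
  obtain ⟨α, hα, i, rfl⟩ := hd
  have hm : g (α.args i) ∈ (α.map g).argList := Atom.mem_argList.2 ⟨i, rfl⟩
  exact ⟨CInstance.mem_terms.2 ⟨_, hI α hα, hm⟩, eval_domCond_eq_one.2 ⟨_, hI α hα, rfl, hm⟩⟩

/-- Positive formulas are preserved by homomorphisms into the unconditional facts of `J`. -/
theorem CInstance.eval_condEval_of_hom {I : Instance} {J : CInstance} {g : Val → Val}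
    (hI : ∀ α ∈ I, (α.map g, Condition.tru) ∈ J) {φ : Formula} (hφ : φ.Pos)
    (hg : ∀ c ∈ φ.constSet, g (.const c) = .const c) {σ : Var → Val} (h : φ.Holds I σ) :
    (J.condEval φ (g ∘ σ)).eval = 1 := by
  have hmax : ∀ s t : SignType, max s t = 1 ↔ s = 1 ∨ t = 1 := by decide
  induction φ generalizing σ with
  | atom a =>
    simp only [condEval, eval_disj, supList_eq_one, List.mem_map]
    refine ⟨_, ⟨_, hI _ h, rfl⟩, ?_⟩
    rw [Atom.map_inst_comp hg]
    simp only [Condition.eval, sign_min_eq_one, true_and]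
    rw [matchCond, if_pos rfl, eval_conj, infList_eq_one]
    simp [Condition.eval, evalEq]
  | and φ ψ ih₁ ih₂ =>
    exact sign_min_eq_one.2 ⟨ih₁ hφ.1 (fun c hc => hg c (.inl hc)) h.1,
      ih₂ hφ.2 (fun c hc => hg c (.inr hc)) h.2⟩
  | or φ ψ ih₁ ih₂ =>
    refine (hmax _ _).2 ?_
    exact h.imp (ih₁ hφ.1 fun c hc => hg c (.inl hc)) (ih₂ hφ.2 fun c hc => hg c (.inr hc))
  | ex x φ ih =>
    obtain ⟨d, hd, h⟩ := h
    simp only [condEval, eval_disj, supList_eq_one, List.mem_map]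
    refine ⟨_, ⟨g d, (eval_domCond_of_hom hI hd).1, rfl⟩, ?_⟩
    refine sign_min_eq_one.2 ⟨(eval_domCond_of_hom hI hd).2, ?_⟩
    rw [← Function.comp_update]
    exact ih hφ hg h
  | _ => exact hφ.elim

/-- Null-free answers to positive queries are preserved by homomorphisms into the unconditional
facts of `J`. -/
theorem Query.mem_trueAnswers_of_hom {Q : Query} (hQ : Q.IsPositive) {I : Instance} {J : CInstance}
    {g : Val → Val} (hI : ∀ α ∈ I, (α.map g, Condition.tru) ∈ J)
    (hg : ∀ c ∈ Q.formula.constSet, g (.const c) = .const c) {t : Fin Q.arity → Val}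
    (ht : t ∈ Q.answers I) (hc : ∀ i, ∃ c, t i = .const c) (hgt : ∀ i, g (t i) = t i) :
    t ∈ Q.trueAnswers J := by
  obtain ⟨hd, σ, hσ, h⟩ := ht
  refine ⟨hc, _, ⟨g ∘ σ, fun i => ?_, fun i => ?_, rfl⟩, ?_⟩
  · rw [Function.comp_apply, hσ]
    exact (eval_domCond_of_hom hI (hd i)).1
  · rw [Function.comp_apply, hσ, hgt]
  · refine sign_min_eq_one.2 ⟨?_, CInstance.eval_condEval_of_hom hI (Formula.IsUCQ.pos hQ) hg h⟩
    rw [eval_conj, infList_eq_one]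
    simp only [List.mem_map, List.mem_ofFn]
    rintro _ ⟨_, ⟨i, rfl⟩, rfl⟩
    rw [Function.comp_apply, hσ]
    exact (eval_domCond_of_hom hI (hd i)).2

/-! ### The chase -/

/-- Interpretations of the Skolem functions of TGDs. -/
abbrev Skolem := TGD → (Var → Val) → Var → Val

/-- The values depend on the frontier only. -/
def Skolem.Local (sk : Skolem) : Prop :=
  ∀ ρ h h', (∀ x ∈ ρ.frontier, h x = h' x) → sk ρ h = sk ρ h'

open Classical in
/-- The extension of an assignment to the existential variables. -/
noncomputable def Skolem.extend (sk : Skolem) (ρ : TGD) (h : Var → Val) (x : Var) : Val :=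
  if x ∈ varsOf ρ.body then h x else sk ρ h x

/-- The facts derived by the skolemized TGDs. -/
inductive Chase (D : Set TGD) (sk : Skolem) (I : Instance) : DBFact → Prop
  | rule (ρ : TGD) (hρ : ρ ∈ D) (h : Var → Val)
      -- Each body atom is instantiated in `I` or derived earlier. The facts of `I` are not
      -- themselves counted as derived.
      (hb : ∀ a ∈ ρ.body, a.map (Term.inst h) ∉ I → Chase D sk I (a.map (Term.inst h)))
      (a : Atom Term) (ha : a ∈ ρ.head) : Chase D sk I (a.map (Term.inst (sk.extend ρ h)))

/-- The instance derived by the skolemized TGDs. -/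
def chase (D : Set TGD) (sk : Skolem) (I : Instance) : Instance := {α | Chase D sk I α}

section
variable {D : Set TGD} {sk : Skolem} {I : Instance}

theorem mem_chase_of_isHom {ρ : TGD} (hρ : ρ ∈ D) {h : Var → Val}
    (hb : IsHom h ρ.body (I ∪ chase D sk I)) {a : Atom Term} (ha : a ∈ ρ.head) :
    a.map (Term.inst (sk.extend ρ h)) ∈ chase D sk I :=
  Chase.rule ρ hρ h (fun b hbb hI => (hb b hbb).resolve_left hI) a ha

/-- The body is available twice: as facts of `I` or the chase, and as facts of `I` or satisfying
`P`. The first form lets arguments use properties of the chase already established. -/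
theorem chase_induction {P : DBFact → Prop}
    (hP : ∀ ρ ∈ D, ∀ h, IsHom h ρ.body (I ∪ chase D sk I) →
      IsHom h ρ.body (I ∪ {α | P α}) → ∀ a ∈ ρ.head, P (a.map (Term.inst (sk.extend ρ h))))
    {α : DBFact} (hα : α ∈ chase D sk I) : P α := by
  induction hα with
  | rule ρ hρ h hb a ha ih =>
    exact hP ρ hρ h (fun b hbb => or_iff_not_imp_left.2 (hb b hbb))
      (fun b hbb => or_iff_not_imp_left.2 (ih b hbb)) a ha

theorem IsHom.mono {h : Var → Val} {A : List (Atom Term)} {K K' : Instance} (hh : IsHom h A K)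
    (hK : K ⊆ K') : IsHom h A K' := fun a ha => hK (hh a ha)

theorem IsHom.exists_arg {h : Var → Val} {A : List (Atom Term)} {K : Instance}
    (hh : IsHom h A K) {x : Var} (hx : x ∈ varsOf A) : ∃ α ∈ K, ∃ i, α.args i = h x := by
  obtain ⟨a, ha, i, hi⟩ := hx
  exact ⟨_, hh a ha, i, by simp [Atom.map, hi, Term.inst]⟩

theorem Skolem.extend_of_mem {ρ : TGD} {x : Var} (hx : x ∈ varsOf ρ.body) (h : Var → Val) :
    sk.extend ρ h x = h x := if_pos hx

theorem Skolem.extend_of_notMem {ρ : TGD} {x : Var} (hx : x ∉ varsOf ρ.body) (h : Var → Val) :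
    sk.extend ρ h x = sk ρ h x := if_neg hx

/-- Mappings that are compatible with the Skolem functions map chases to chases. -/
theorem map_mem_chase {sk' : Skolem} {g : Val → Val}
    (hbody : ∀ ρ ∈ D, ∀ a ∈ ρ.body, ∀ c ∈ a.constSet, g (.const c) = .const c)
    (hhead : ∀ ρ ∈ D, ∀ a ∈ ρ.head, ∀ c ∈ a.constSet, g (.const c) = .const c)
    (hI : ∀ α ∈ I, α.map g = α)
    (hg : ∀ ρ ∈ D, ∀ h, IsHom h ρ.body (I ∪ chase D sk I) → ∀ z ∈ ρ.exvar,
      g (sk ρ h z) = sk' ρ (g ∘ h) z) {α : DBFact} (hα : α ∈ chase D sk I) :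
    α.map g ∈ chase D sk' I := by
  refine chase_induction (P := fun α => α.map g ∈ chase D sk' I) (fun ρ hρ h hb ih a ha => ?_) hα
  have hb' : IsHom (g ∘ h) ρ.body (I ∪ chase D sk' I) := by
    intro b hbb
    rw [← Atom.map_inst_comp (hbody ρ hρ b hbb)]
    rcases ih b hbb with h1 | h1
    · rw [hI _ h1]; exact .inl h1
    · exact .inr h1
  rw [Atom.map_inst_comp (hhead ρ hρ a ha)]
  have := mem_chase_of_isHom hρ hb' ha
  rwa [Atom.inst_congr (τ := g ∘ sk.extend ρ h)] at this
  intro i x hx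
  by_cases hxb : x ∈ varsOf ρ.body
  · simp [Skolem.extend_of_mem hxb]
  · simp only [Skolem.extend_of_notMem hxb, Function.comp_apply]
    exact (hg ρ hρ h hb x ⟨⟨a, ha, i, hx⟩, hxb⟩).symm

end

/-! ### Supported solutions of settings without EGDs -/

/-- The constant denoted by a value; nulls are given a default. -/
def Val.toConst : Val → Const
  | .const c => c
  | .null _ => []

open Classical in
/-- The Skolem functions given by an ex-choice. -/
noncomputable def ExChoice.skolem (γ : ExChoice) : Skolem := fun ρ h z =>
  if hz : z ∈ ρ.exvar then .const (γ ρ (fun x => (h x).toConst) ⟨z, hz⟩) else .const []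

theorem ExChoice.skolem_local (γ : ExChoice) : γ.skolem.Local := by
  intro ρ h h' hh
  funext z
  have : (fun x : ρ.frontier => (h x).toConst) = fun x : ρ.frontier => (h' x).toConst :=
    funext fun x => by rw [hh x x.2]
  simp only [skolem, this]

theorem ExChoice.skolem_const (γ : ExChoice) (ρ : TGD) (h : Var → Val) (z : Var) :
    .const (γ.skolem ρ h z).toConst = γ.skolem ρ h z := by
  rw [skolem]
  split_ifs <;> rfl

theorem isHom_ground {h : Var → Const} {h' : Var → Val} {A : List (Atom Term)} {K : Instance} :
    IsHom h' (A.map (Atom.map (Term.ground h))) K ↔ IsHom (Val.const ∘ h) A K := by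
  have : ∀ a : Atom Term, (a.map (Term.ground h)).map (Term.inst h') =
      a.map (Term.inst (Val.const ∘ h)) := by
    intro a
    simp only [Atom.map, Atom.mk.injEq, heq_eq_eq, true_and]
    funext i
    cases a.args i <;> rfl
  simp [IsHom, this]

theorem TGD.sat_groundVersion {ρ : TGD} {h : Var → Const} {K : Instance} :
    (ρ.groundVersion h).Sat K ↔
      (IsHom (Val.const ∘ h) ρ.body K → IsHom (Val.const ∘ h) ρ.head K) := by
  simp only [TGD.Sat, TGD.groundVersion, isHom_ground]
  exact ⟨fun H hb => (H (fun _ => .const []) hb).choose_spec.2,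
    fun H h' hb => ⟨h', fun _ _ => rfl, H hb⟩⟩

/-- All the TGDs of a setting. -/
def Setting.tgds (S : Setting) : Set TGD := S.stTGDs ∪ S.tgtTGDs

section
variable {S : Setting} {sk : Skolem} {I : Instance}

theorem Setting.head_over {ρ : TGD} (hρ : ρ ∈ S.tgds) : AtomsOver S.target ρ.head :=
  hρ.elim (fun h => (S.stTGDs_over ρ h).2) fun h => (S.tgtTGDs_over ρ h).2

theorem Setting.chase_over {α : DBFact} (hα : α ∈ chase S.tgds sk I) : α.rel ∈ S.target :=
  chase_induction (P := fun α => α.rel ∈ S.target)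
    (fun _ hρ _ _ _ a ha => S.head_over hρ a ha) hα

theorem Setting.source_target {R : RelSym} (h : R ∈ S.source) (h' : R ∈ S.target) : False :=
  Set.disjoint_left.1 S.disjoint h h'

theorem Setting.isHom_source {A : List (Atom Term)} (hA : AtomsOver S.source A) {h : Var → Val}
    {J : Instance} (hJ : ∀ α ∈ J, α.rel ∈ S.target) (hh : IsHom h A (I ∪ J)) : IsHom h A I :=
  fun a ha => (hh a ha).resolve_right fun hc => S.source_target (hA a ha) (hJ _ hc)

theorem Setting.isHom_target {A : List (Atom Term)} (hA : AtomsOver S.target A) {h : Var → Val}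
    {J : Instance} (hI : ∀ α ∈ I, α.rel ∈ S.source) (hh : IsHom h A (I ∪ J)) : IsHom h A J :=
  fun a ha => (hh a ha).resolve_left fun hc => S.source_target (hI _ hc) (hA a ha)

theorem Setting.chase_nullFree (hI : NullFree I) (γ : ExChoice) :
    NullFree (chase S.tgds γ.skolem I) := by
  intro α hα
  refine chase_induction (P := fun α => ∀ i, ∃ c, α.args i = .const c)
    (fun ρ hρ h _ ih a ha i => ?_) hα
  simp only [Atom.map]
  cases e : a.args i with
  | const c => exact ⟨c, rfl⟩
  | var x =>
    simp only [Term.inst]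
    by_cases hx : x ∈ varsOf ρ.body
    · rw [Skolem.extend_of_mem hx]
      obtain ⟨β, hβ, j, hj⟩ := ih.exists_arg hx
      rw [← hj]
      exact hβ.elim (fun h => hI β h j) fun h => h j
    · rw [Skolem.extend_of_notMem hx]
      exact ⟨_, (γ.skolem_const ρ h x).symm⟩

theorem Setting.chase_sat (hS : S.TGDOnly) (γ : ExChoice) :
    S.SatWith γ I (chase S.tgds γ.skolem I) := by
  have key : ∀ ρ ∈ S.tgds, ∀ h : Var → Const, Coherent γ ρ h →
      IsHom (Val.const ∘ h) ρ.body (I ∪ chase S.tgds γ.skolem I) →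
      IsHom (Val.const ∘ h) ρ.head (chase S.tgds γ.skolem I) := by
    intro ρ hρ h hc hb a ha
    have := mem_chase_of_isHom hρ hb ha
    rwa [Atom.inst_congr (τ := Val.const ∘ h)] at this
    intro i x hx
    by_cases hxb : x ∈ varsOf ρ.body
    · rw [Skolem.extend_of_mem hxb]
    · have hz : x ∈ ρ.exvar := ⟨⟨a, ha, i, hx⟩, hxb⟩
      rw [Skolem.extend_of_notMem hxb, ExChoice.skolem, dif_pos hz, Function.comp_apply,
        hc ⟨x, hz⟩]
      rfl
  refine ⟨?_, ?_, fun η hη => ?_⟩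
  · rintro _ ⟨ρ, hρ, h, hc, rfl⟩
    exact TGD.sat_groundVersion.2 fun hb =>
      (key ρ (.inl hρ) h hc hb).mono Set.subset_union_right
  · rintro _ ⟨ρ, hρ, h, hc, rfl⟩
    exact TGD.sat_groundVersion.2 fun hb =>
      key ρ (.inr hρ) h hc (hb.mono Set.subset_union_right)
  · rw [hS] at hη
    exact hη.elim

/-- Every derivation step uses only constants and is an instance of a ground TGD coherent with `γ`,
so any model contains its conclusion. With `Setting.chase_sat` this makes the chase the least model
for `γ`. -/
theorem Setting.chase_subset (hI : ∀ α ∈ I, α.rel ∈ S.source) (hn : NullFree I) {γ : ExChoice}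
    {J : Instance} (hsat : S.SatWith γ I J) :
    chase S.tgds γ.skolem I ⊆ J := by
  intro α hα
  refine chase_induction (P := fun α => α ∈ J) (fun ρ hρ h hb ih a ha => ?_) hα
  have hconst : ∀ x ∈ varsOf ρ.body, .const (h x).toConst = h x := by
    intro x hx
    obtain ⟨β, hβ, j, hj⟩ := hb.exists_arg hx
    obtain ⟨c, hc⟩ := hβ.elim (fun h => hn β h j) fun h => S.chase_nullFree hn γ β h j
    rw [← hj, hc]
    rfl
  have hext : ∀ x, Val.const (γ.skolem.extend ρ h x).toConst = γ.skolem.extend ρ h x := by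
    intro x
    by_cases hx : x ∈ varsOf ρ.body
    · rw [Skolem.extend_of_mem hx, hconst x hx]
    · rw [Skolem.extend_of_notMem hx, γ.skolem_const]
  have hcomp : Val.const ∘ (fun x => (γ.skolem.extend ρ h x).toConst) = γ.skolem.extend ρ h :=
    funext hext
  -- Extending `h` leaves the frontier unchanged, so `γ` is consulted at the same tuple before and
  -- after.
  have hcoh : Coherent γ ρ fun x => (γ.skolem.extend ρ h x).toConst := by
    intro z
    have h1 : γ.skolem.extend ρ h z = .const (γ ρ (fun x => (h x).toConst) z) := by
      rw [Skolem.extend_of_notMem z.2.2, ExChoice.skolem, dif_pos z.2]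
    have h2 : (fun x : ρ.frontier => (h x).toConst) =
        fun x : ρ.frontier => (γ.skolem.extend ρ h x).toConst :=
      funext fun x => by rw [Skolem.extend_of_mem x.2.1]
    exact (congrArg Val.toConst h1).trans (congrArg (fun t => γ ρ t z) h2)
  have hb' : IsHom (γ.skolem.extend ρ h) ρ.body (I ∪ J) := by
    intro b hbb
    have := ih b hbb
    rwa [Atom.inst_congr (τ := γ.skolem.extend ρ h)] at this
    intro i x hx
    rw [Skolem.extend_of_mem ⟨b, hbb, i, hx⟩]
  rcases hρ with hρ | hρ
  · have := TGD.sat_groundVersion.1 (hsat.1 _ ⟨ρ, hρ, _, hcoh, rfl⟩)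
    rw [hcomp] at this
    exact (this hb' a ha).resolve_left fun hc =>
      S.source_target (hI _ hc) ((S.stTGDs_over ρ hρ).2 a ha)
  · have := TGD.sat_groundVersion.1 (hsat.2.1 _ ⟨ρ, hρ, _, hcoh, rfl⟩)
    rw [hcomp] at this
    exact this (S.isHom_target (S.tgtTGDs_over ρ hρ).1 hI hb') a ha

/-- When the chases are finite, the supported solutions are the chases with the Skolem functions
given by ex-choices. -/
theorem Setting.mem_ssol (hS : S.TGDOnly) (hI : S.IsSourceInstance I)
    (hfin : ∀ γ : ExChoice, (chase S.tgds γ.skolem I).Finite) {J : Instance} :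
    J ∈ S.ssol I ↔ ∃ γ : ExChoice, J = chase S.tgds γ.skolem I := by
  have hinst : ∀ γ : ExChoice, IsInstance S.target (chase S.tgds γ.skolem I) :=
    fun γ => ⟨hfin γ, fun α hα => S.chase_over hα⟩
  constructor
  · rintro ⟨hJ, γ, hsat, hmin⟩
    refine ⟨γ, ?_⟩
    by_contra hne
    exact hmin _ (hinst γ) ((S.chase_subset hI.1.2 hI.2 hsat).ssubset_of_ne (Ne.symm hne))
      (S.chase_sat hS γ)
  · rintro ⟨γ, rfl⟩
    exact ⟨hinst γ, γ, S.chase_sat hS γ, fun J' hJ' hss hsat =>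
      hss.not_subset (S.chase_subset hI.1.2 hI.2 hsat)⟩

end

/-! ### Ranks of positions -/

/-- Edges of the dependency graph. -/
def DepEdge (D : Set TGD) (π π' : Position) : Prop := NormalEdge D π π' ∨ SpecialEdge D π π'

/-- The special edges that lead to `π`. -/
def specialInto (D : Set TGD) (π : Position) : Set (Position × Position) :=
  {e | SpecialEdge D e.1 e.2 ∧ Relation.ReflTransGen (DepEdge D) e.2 π}

/-- The rank of a position. -/
noncomputable def posRank (D : Set TGD) (π : Position) : ℕ := (specialInto D π).ncard

theorem finite_occursAt (A : List (Atom Term)) : {π | ∃ x, OccursAt A x π}.Finite := by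
  refine (A.finite_toSet.biUnion fun a _ =>
    Set.finite_range fun i : Fin a.rel.arity => (⟨a.rel, i⟩ : Position)).subset ?_
  rintro π ⟨x, a, ha, i, -, rfl⟩
  exact Set.mem_biUnion ha ⟨i, rfl⟩

theorem finite_specialEdge {D : Set TGD} (hD : D.Finite) :
    {e : Position × Position | SpecialEdge D e.1 e.2}.Finite := by
  refine (hD.biUnion fun ρ _ => (finite_occursAt ρ.body).prod (finite_occursAt ρ.head)).subset ?_
  rintro ⟨π, π'⟩ ⟨ρ, hρ, x, -, hx, z, -, hz⟩
  exact Set.mem_biUnion hρ ⟨⟨x, hx⟩, ⟨z, hz⟩⟩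

section
variable {D : Set TGD}

theorem posRank_le (hD : D.Finite) (π : Position) :
    posRank D π ≤ {e : Position × Position | SpecialEdge D e.1 e.2}.ncard :=
  Set.ncard_le_ncard (fun _ he => he.1) (finite_specialEdge hD)

theorem posRank_mono (hD : D.Finite) {π π' : Position} (h : NormalEdge D π π') :
    posRank D π ≤ posRank D π' :=
  Set.ncard_le_ncard (fun _ he => ⟨he.1, he.2.tail (.inl h)⟩)
    ((finite_specialEdge hD).subset fun _ he => he.1)

/-- The edge itself is counted at its target. Were it counted at its source, it would lie on a
cycle, against weak acyclicity. -/
theorem posRank_lt (hD : D.Finite) (hWA : WeaklyAcyclic D) {π π' : Position}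
    (h : SpecialEdge D π π') : posRank D π < posRank D π' := by
  refine Set.ncard_lt_ncard ⟨fun _ he => ⟨he.1, he.2.tail (.inr h)⟩, fun hsub => ?_⟩
    ((finite_specialEdge hD).subset fun _ he => he.1)
  exact hWA π π' h (hsub (⟨h, .refl⟩ : ((π, π') : Position × Position) ∈ specialInto D π')).2

end

/-! ### Candidate values and facts -/

/-- The variables of `ρ` and the arities of its head are bounded by `m`. -/
def TGD.BoundedBy (ρ : TGD) (m : ℕ) : Prop :=
  (∀ x ∈ varsOf ρ.body, x < m) ∧ (∀ x ∈ varsOf ρ.head, x < m) ∧ ∀ a ∈ ρ.head, a.rel.arity ≤ m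

/-- The values obtained from those of `V` by `i` rounds of applying Skolem functions. -/
def skolemValues (D : List TGD) (m : ℕ) (sk : Skolem) (V : List Val) : ℕ → List Val
  | 0 => V
  | i + 1 => skolemValues D m sk V i ++ D.flatMap fun ρ => (List.range m).flatMap fun z =>
      (tuples (skolemValues D m sk V i) m).map fun e => sk ρ (env e) z

/-- The atom whose arguments are distinct variables. -/
def RelSym.generic (R : RelSym) : Atom Term := ⟨R, fun i => .var i⟩

/-- The facts over `V` with the relations of the heads. -/
def candidates (D : List TGD) (m : ℕ) (V : List Val) : List DBFact :=
  D.flatMap fun ρ => ρ.head.flatMap fun a => (tuples V m).map fun e =>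
    a.rel.generic.map (Term.inst (env e))

/-- A default value, the constants of the heads and the values in `L`. -/
def baseValues (D : List TGD) (L : List DBFact) : List Val :=
  .const [] :: ((D.flatMap fun ρ => ρ.head.flatMap fun a =>
    a.argList.map (Term.inst fun _ => .const [])) ++ L.flatMap Atom.argList)

section
variable {D : List TGD} {m : ℕ} {sk : Skolem} {V : List Val}

theorem skolemValues_mono {i j : ℕ} (h : i ≤ j) :
    skolemValues D m sk V i ⊆ skolemValues D m sk V j := by
  induction h with
  | refl => exact List.Subset.refl _
  | step _ ih => exact List.Subset.trans ih (List.subset_append_left _ _)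

/-- By locality, `h` may be replaced by a tuple over the current values that agrees with it on the
frontier. -/
theorem skolem_mem_skolemValues (hsk : sk.Local) (hV : .const [] ∈ V) {ρ : TGD} (hρ : ρ ∈ D)
    (hm : ρ.BoundedBy m) {h : Var → Val} {i : ℕ}
    (hh : ∀ x ∈ ρ.frontier, h x ∈ skolemValues D m sk V i) {z : Var} (hz : z < m) :
    sk ρ h z ∈ skolemValues D m sk V (i + 1) := by
  obtain ⟨e, he, hev⟩ := exists_tuple_env m (skolemValues D m sk V i)
    (skolemValues_mono (Nat.zero_le i) hV) h
  refine List.mem_append_right _ (List.mem_flatMap.2 ⟨ρ, hρ, List.mem_flatMap.2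
    ⟨z, List.mem_range.2 hz, List.mem_map.2 ⟨e, he, ?_⟩⟩⟩)
  rw [hsk ρ (env e) h fun x hx => hev x (hm.1 x hx.1) (hh x hx)]

theorem mem_candidates {V : List Val} (hV : .const [] ∈ V) {ρ : TGD} (hρ : ρ ∈ D)
    (hm : ρ.BoundedBy m) {α : DBFact} (hα : ∃ a ∈ ρ.head, a.rel = α.rel)
    (hargs : ∀ i, α.args i ∈ V) : α ∈ candidates D m V := by
  obtain ⟨a, ha, har⟩ := hα
  obtain ⟨R, f⟩ := α
  obtain rfl : a.rel = R := har
  obtain ⟨e, he, hev⟩ := exists_tuple_env m V hV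
    fun x => if hx : x < a.rel.arity then f ⟨x, hx⟩ else .const []
  refine List.mem_flatMap.2 ⟨ρ, hρ, List.mem_flatMap.2 ⟨a, ha, List.mem_map.2 ⟨e, he, ?_⟩⟩⟩
  simp only [RelSym.generic, Atom.map, Atom.mk.injEq, heq_eq_eq, true_and, Term.inst]
  funext i
  have h1 := hev i (i.2.trans_le (hm.2.2 a ha))
  simp only [i.2, dif_pos] at h1
  exact h1 (hargs i)

theorem args_mem_of_mem_candidates {V : List Val} (hV : .const [] ∈ V) {α : DBFact}
    (hα : α ∈ candidates D m V) (i) : α.args i ∈ V := by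
  simp only [candidates, List.mem_flatMap, List.mem_map] at hα
  obtain ⟨ρ, -, a, -, e, he, rfl⟩ := hα
  exact env_mem hV he _

theorem const_mem_baseValues {L : List DBFact} {ρ : TGD} (hρ : ρ ∈ D) {a : Atom Term}
    (ha : a ∈ ρ.head) {c : Const} (hc : c ∈ a.constSet) : .const c ∈ baseValues D L := by
  obtain ⟨i, hi⟩ := hc
  refine List.mem_cons_of_mem _ (List.mem_append_left _ (List.mem_flatMap.2 ⟨ρ, hρ,
    List.mem_flatMap.2 ⟨a, ha, List.mem_map.2 ⟨_, Atom.mem_argList.2 ⟨i, hi⟩, rfl⟩⟩⟩))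

theorem arg_mem_baseValues {L : List DBFact} {α : DBFact} (hα : α ∈ L) (i) :
    α.args i ∈ baseValues D L :=
  List.mem_cons_of_mem _ (List.mem_append_right _ (List.mem_flatMap.2 ⟨α, hα,
    Atom.mem_argList.2 ⟨i, rfl⟩⟩))

theorem default_mem_baseValues {L : List DBFact} : .const [] ∈ baseValues D L := by
  simp [baseValues]

/-- The number of rounds after which no new values arise. -/
noncomputable def Setting.depth (S : Setting) : ℕ :=
  {e : Position × Position | SpecialEdge S.tgtTGDs e.1 e.2}.ncard + 1

/-- A value at a position of rank `r` appears within `r + 1` rounds: normal edges do not lower the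
rank and special edges raise it. The additional round is for source-to-target TGDs, which can invent
values at positions of rank 0. The bound holds for all local Skolem functions, hence for all
ex-choices and for the free ones. -/
theorem Setting.chase_subset_candidates {S : Setting} (hWA : S.WeaklyAcyclic) {L : List DBFact}
    (hL : ∀ α ∈ L, α.rel ∈ S.source) (hD : ∀ ρ, ρ ∈ D ↔ ρ ∈ S.tgds)
    (hm : ∀ ρ ∈ D, ρ.BoundedBy m) (hsk : sk.Local) {α : DBFact}
    (hα : α ∈ chase S.tgds sk {α | α ∈ L}) :
    α ∈ candidates D m (skolemValues D m sk (baseValues D L) S.depth) := by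
  have hfin := S.tgtTGDs_finite
  have key : ∀ i, α.args i ∈
      skolemValues D m sk (baseValues D L) (posRank S.tgtTGDs ⟨α.rel, i⟩ + 1) := by
    refine chase_induction (P := fun α => ∀ i, α.args i ∈
      skolemValues D m sk (baseValues D L) (posRank S.tgtTGDs ⟨α.rel, i⟩ + 1))
      (fun ρ hρ h hb ih a ha i => ?_) hα
    simp only [Atom.map]
    cases e : a.args i with
    | const c =>
      exact skolemValues_mono (Nat.zero_le _) (const_mem_baseValues ((hD ρ).2 hρ) ha ⟨i, e⟩)
    | var x =>
      simp only [Term.inst]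
      have hxh : x ∈ varsOf ρ.head := ⟨a, ha, i, e⟩
      have hocc : OccursAt ρ.head x ⟨a.rel, i⟩ := ⟨a, ha, i, e, rfl⟩
      have hmρ := hm ρ ((hD ρ).2 hρ)
      have hsource : ρ ∈ S.stTGDs → ∀ y ∈ varsOf ρ.body, h y ∈ baseValues D L := by
        intro hst y hy
        obtain ⟨β, hβ, j, hj⟩ := (S.isHom_source (S.stTGDs_over ρ hst).1
          (fun α hα => S.chase_over hα) hb).exists_arg hy
        rw [← hj]
        exact arg_mem_baseValues hβ j
      have htarget : ρ ∈ S.tgtTGDs → ∀ y ∈ varsOf ρ.body, ∃ π, OccursAt ρ.body y π ∧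
          h y ∈ skolemValues D m sk (baseValues D L) (posRank S.tgtTGDs π + 1) := by
        rintro htgt y ⟨b, hbb, j, hj⟩
        refine ⟨⟨b.rel, j⟩, ⟨b, hbb, j, hj, rfl⟩, ?_⟩
        have := (ih b hbb).resolve_left (fun hc => S.source_target (hL _ hc)
          ((S.tgtTGDs_over ρ htgt).1 b hbb)) j
        simpa only [Atom.map, hj, Term.inst] using this
      by_cases hxb : x ∈ varsOf ρ.body
      · rw [Skolem.extend_of_mem hxb]
        rcases hρ with hst | htgt
        · exact skolemValues_mono (Nat.zero_le _) (hsource hst x hxb)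
        · obtain ⟨π, hπ, hv⟩ := htarget htgt x hxb
          exact skolemValues_mono (Nat.succ_le_succ (posRank_mono hfin
            ⟨ρ, htgt, x, ⟨hxb, hxh⟩, hπ, hocc⟩)) hv
      · rw [Skolem.extend_of_notMem hxb]
        refine skolem_mem_skolemValues hsk default_mem_baseValues ((hD ρ).2 hρ) hmρ
          (fun y hy => ?_) (hmρ.2.1 x hxh)
        rcases hρ with hst | htgt
        · exact skolemValues_mono (Nat.zero_le _) (hsource hst y hy.1)
        · obtain ⟨π, hπ, hv⟩ := htarget htgt y hy.1
          exact skolemValues_mono (posRank_lt hfin hWA ⟨ρ, htgt, y, hy, hπ, x, ⟨hxh, hxb⟩, hocc⟩) hv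
  obtain ⟨ρ, hρ, hr⟩ : ∃ ρ ∈ S.tgds, ∃ a ∈ ρ.head, a.rel = α.rel :=
    chase_induction (P := fun α => ∃ ρ ∈ S.tgds, ∃ a ∈ ρ.head, a.rel = α.rel)
      (fun ρ hρ _ _ _ a ha => ⟨ρ, hρ, a, ha, rfl⟩) hα
  exact mem_candidates (skolemValues_mono (Nat.zero_le _) default_mem_baseValues) ((hD ρ).2 hρ)
    (hm ρ ((hD ρ).2 hρ)) hr fun i => skolemValues_mono (Nat.succ_le_succ (posRank_le hfin _)) (key i)

end

/-! ### Names of nulls -/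

/-- The string of a value. -/
def Val.str : Val → List Bool
  | .const c => c
  | .null n => n

/-- Whether a value is a null. -/
def Val.isNull : Val → Bool
  | .const _ => false
  | .null _ => true

/-- A prefix code for values. -/
def Val.code (v : Val) : List Bool := v.str.flatMap (fun b => [true, b]) ++ [false, v.isNull]

/-- The name given to a list of values. -/
def nullName (l : List Val) : Null := l.flatMap Val.code

/-- Every bit is announced by `true`, so the first `false` in an announcing place marks the end of
the string. -/
theorem flatMap_bits_append {c d s t : List Bool}
    (h : c.flatMap (fun b => [true, b]) ++ false :: s = d.flatMap (fun b => [true, b]) ++ false :: t) :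
    c = d ∧ s = t := by
  induction c generalizing d with
  | nil => cases d <;> simp_all
  | cons b c ih =>
    cases d with
    | nil => simp at h
    | cons b' d =>
      simp only [List.flatMap_cons, List.cons_append, List.nil_append, List.cons.injEq,
        true_and] at h
      obtain ⟨h1, h2⟩ := ih h.2
      exact ⟨by rw [h.1, h1], h2⟩

theorem Val.code_append {v w : Val} {s t : List Bool} (h : v.code ++ s = w.code ++ t) :
    v = w ∧ s = t := by
  simp only [code, List.append_assoc, List.cons_append, List.nil_append] at h
  obtain ⟨h1, h2⟩ := flatMap_bits_append h
  simp only [List.cons.injEq] at h2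
  refine ⟨?_, h2.2⟩
  cases v <;> cases w <;> simp_all [str, isNull]

theorem nullName_injective : Function.Injective nullName := by
  intro l l' h
  induction l generalizing l' with
  | nil => cases l' <;> simp_all [nullName, Val.code]
  | cons v l ih =>
    cases l' with
    | nil => simp [nullName, Val.code] at h
    | cons w l' =>
      obtain ⟨h1, h2⟩ := Val.code_append (h : v.code ++ nullName l = w.code ++ nullName l')
      rw [h1, ih h2]

/-- This is the measure for recursion along names: a null is named by a list whose nulls have
shorter names. -/
theorem length_lt_nullName {l : List Val} {n : Null} (h : .null n ∈ l) :
    n.length < (nullName l).length := by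
  induction l with
  | nil => simp at h
  | cons v l ih =>
    have e : (nullName (v :: l)).length = v.code.length + (nullName l).length := by
      simp [nullName]
    rw [e]
    rcases List.mem_cons.1 h with rfl | h
    · have : n.length ≤ (n.flatMap fun b => [true, b]).length := by
        induction n with
        | nil => simp
        | cons b n ih => simp at ih ⊢; omega
      simp only [Val.code, Val.str, List.length_append, List.length_cons]
      omega
    · have := ih h
      omega

/-- Valuations can be defined by recursion along the names of nulls. -/
theorem exists_valuation_nullName (Φ : List Val → Const) :
    ∃ ν : Null → Const, ∀ l, ν (nullName l) = Φ (l.map (applyVal ν)) := by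
  classical
  let step (ν : Null → Const) (n : Null) : Const :=
    if h : ∃ l, nullName l = n then Φ (h.choose.map (applyVal ν)) else []
  have hstep : ∀ ν l, step ν (nullName l) = Φ (l.map (applyVal ν)) := by
    intro ν l
    have h : ∃ l', nullName l' = nullName l := ⟨l, rfl⟩
    simp only [step, dif_pos h, nullName_injective h.choose_spec]
  let approx (k : ℕ) : Null → Const := step^[k] fun _ => []
  have hsucc : ∀ k, approx (k + 1) = step (approx k) := fun k => Function.iterate_succ_apply' _ _ _
  have hmap : ∀ (μ ν : Null → Const) (l : List Val),
      (∀ n' : Null, n'.length < (nullName l).length → μ n' = ν n') →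
      l.map (applyVal μ) = l.map (applyVal ν) := by
    intro μ ν l h
    refine List.map_congr_left fun v hv => ?_
    cases v with
    | const c => rfl
    | null n => exact congrArg Val.const (h n (length_lt_nullName hv))
  -- The value at a name depends only on values at shorter names, so it is final once there have
  -- been more rounds than the name has letters.
  have hstab : ∀ (n : Null) (j k : ℕ), n.length < j → n.length < k → approx j n = approx k n := by
    intro n
    induction hn : n.length using Nat.strong_induction_on generalizing n with
    | _ N ih =>
      subst hn
      intro j k hj hk
      obtain ⟨j, rfl⟩ := Nat.exists_eq_add_of_lt (Nat.zero_lt_of_lt hj)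
      obtain ⟨k, rfl⟩ := Nat.exists_eq_add_of_lt (Nat.zero_lt_of_lt hk)
      simp only [Nat.zero_add, hsucc] at hj hk ⊢
      by_cases h : ∃ l, nullName l = n
      · obtain ⟨l, rfl⟩ := h
        rw [hstep, hstep, hmap _ _ l fun n' hn' => ih _ hn' n' rfl j k (by omega) (by omega)]
      · simp only [step, dif_neg h]
  refine ⟨fun n => approx (n.length + 1) n, fun l => ?_⟩
  change approx ((nullName l).length + 1) (nullName l) = _
  rw [hsucc, hstep, hmap _ _ l fun n' hn' => hstab n' _ _ hn' (Nat.lt_succ_self _)]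

/-! ### Free Skolem functions -/

open Classical in
/-- The frontier as a list. -/
noncomputable def TGD.frontierList (ρ : TGD) (m : ℕ) : List Var :=
  (List.range m).filter fun x => x ∈ ρ.frontier

open Classical in
/-- The list of values that names the null for an existential variable. -/
noncomputable def skolemList (D : List TGD) (m : ℕ) (ρ : TGD) (h : Var → Val) (z : Var) :
    List Val :=
  .const [true] :: .const (.replicate (D.idxOf ρ) true) :: .const (.replicate z true) ::
    (ρ.frontierList m).map h

/-- Skolem functions whose values are nulls, different for different arguments. -/
noncomputable def freeSkolem (D : List TGD) (m : ℕ) : Skolem := fun ρ h z =>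
  .null (nullName (skolemList D m ρ h z))

/-- The list of values that names the null for a fact. -/
def flagList (α : DBFact) : List Val := .const [] :: .const α.rel.name :: α.argList

/-- The null whose value tells whether the fact holds. -/
def flagNull (α : DBFact) : Val := .null (nullName (flagList α))

section
variable {D : List TGD} {m : ℕ}

theorem mem_frontierList {ρ : TGD} (hm : ρ.BoundedBy m) {x : Var} :
    x ∈ ρ.frontierList m ↔ x ∈ ρ.frontier := by
  simp only [TGD.frontierList, List.mem_filter, List.mem_range, decide_eq_true_eq,
    and_iff_right_iff_imp]
  exact fun h => hm.1 x h.1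

theorem freeSkolem_local : (freeSkolem D m).Local := by
  intro ρ h h' hh
  funext z
  simp only [freeSkolem, skolemList]
  rw [List.map_congr_left fun x hx => hh x (by
    simpa [TGD.frontierList] using (List.mem_filter.1 hx).2)]

/-- Under a valuation, the list naming a Skolem term becomes the list for the evaluated arguments.
The recursion for valuations thus sees exactly the arguments of the interpreted Skolem function. -/
theorem skolemList_map (ν : Null → Const) (ρ : TGD) (h : Var → Val) (z : Var) :
    (skolemList D m ρ h z).map (applyVal ν) = skolemList D m ρ (applyVal ν ∘ h) z := by
  simp [skolemList, applyVal]

theorem flagList_map (ν : Null → Const) (α : DBFact) :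
    (flagList α).map (applyVal ν) = flagList (α.map (applyVal ν)) := by
  simp only [flagList, List.map_cons, applyVal, Atom.argList_map]
  rfl

theorem flagList_injective : Function.Injective flagList := by
  intro α β h
  simp only [flagList, List.cons.injEq, Val.const.injEq, true_and] at h
  exact Atom.ext_argList h.1 h.2

/-- Every interpretation of the Skolem functions by constants, together with a choice of facts,
comes from a valuation. -/
theorem exists_valuation (hm : ∀ ρ ∈ D, ρ.BoundedBy m) {sk : Skolem} (hsk : sk.Local)
    (hc : ∀ ρ h z, .const (sk ρ h z).toConst = sk ρ h z) (X : Instance) :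
    ∃ ν : Null → Const,
      (∀ ρ ∈ D, ∀ h z, applyVal ν (freeSkolem D m ρ h z) = sk ρ (applyVal ν ∘ h) z) ∧
      ∀ α, applyVal ν (flagNull α) = .const [] ↔ α.map (applyVal ν) ∈ X := by
  classical
  -- The evaluated list shows which kind of null is meant: a flag, set to `[]` when the evaluated
  -- fact is in `X`, or a Skolem term, given its value under `sk`. The default `[true]` differs from
  -- `[]`, so flags of other facts are off.
  obtain ⟨ν, hν⟩ := exists_valuation_nullName fun l =>
    if ∃ α ∈ X, l = flagList α then []
    else if h : ∃ q : TGD × (Var → Val) × Var, q.1 ∈ D ∧ skolemList D m q.1 q.2.1 q.2.2 = l then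
      (sk h.choose.1 h.choose.2.1 h.choose.2.2).toConst
    else [true]
  -- The leading entries differ: `[true]` for Skolem terms and `[]` for flags.
  have hne : ∀ α ρ h z, skolemList D m ρ h z ≠ flagList α := by
    intro α ρ h z
    simp [skolemList, flagList]
  refine ⟨ν, fun ρ hρ h z => ?_, fun α => ?_⟩
  · have hex : ∃ q : TGD × (Var → Val) × Var, q.1 ∈ D ∧
        skolemList D m q.1 q.2.1 q.2.2 = skolemList D m ρ (applyVal ν ∘ h) z :=
      ⟨(ρ, _, z), hρ, rfl⟩
    simp only [freeSkolem, applyVal]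
    rw [hν, skolemList_map, if_neg fun ⟨α, _, e⟩ => hne α _ _ _ e, dif_pos hex, hc]
    obtain ⟨hq, e⟩ := hex.choose_spec
    generalize hex.choose = q at hq e
    obtain ⟨ρ', h', z'⟩ := q
    simp only [skolemList, List.cons.injEq, Val.const.injEq, true_and] at e hq ⊢
    have e1 := congrArg List.length e.1
    have e2 := congrArg List.length e.2.1
    simp only [List.length_replicate] at e1 e2
    obtain rfl := (List.idxOf_inj hq).1 e1
    subst e2
    rw [hsk ρ' h' (applyVal ν ∘ h) fun x hx =>
      List.map_inj_left.1 e.2.2 x ((mem_frontierList (hm _ hρ)).2 hx)]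
  · simp only [flagNull, applyVal, Val.const.injEq]
    rw [hν, flagList_map]
    constructor
    · intro h
      by_contra hX
      rw [if_neg (fun ⟨β, hβ, e⟩ => hX (by rwa [flagList_injective e])),
        dif_neg (fun ⟨q, _, e⟩ => hne _ _ _ _ e)] at h
      simp at h
    · intro h
      rw [if_pos ⟨_, h, rfl⟩]

/-! ### Lifting values and candidate facts along a valuation -/

theorem exists_preimage_tuple {V W : List Val} {ν : Null → Const}
    (h : ∀ v ∈ V, ∃ u ∈ W, applyVal ν u = v) {n : ℕ} {e : List Val} (he : e ∈ tuples V n) :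
    ∃ e' ∈ tuples W n, applyVal ν ∘ env e' = env e := by
  choose! g hgW hg using h
  obtain ⟨hlen, hV⟩ := mem_tuples.1 he
  refine ⟨e.map g, mem_tuples.2 ⟨by simpa using hlen, fun v hv => ?_⟩, funext fun x => ?_⟩
  · obtain ⟨u, hu, rfl⟩ := List.mem_map.1 hv
    exact hgW u (hV u hu)
  · simp only [Function.comp_apply, env, List.getD_eq_getElem?_getD, List.getElem?_map]
    cases hx : e[x]? with
    | none => rfl
    | some v => exact hg v (hV v (List.mem_of_getElem? hx))

/-- Each round with `sk` is the image of the same round with free Skolem functions, as the valuation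
turns the latter into the former and fixes the starting values. -/
theorem exists_preimage_skolemValues {sk : Skolem} {ν : Null → Const}
    (hν : ∀ ρ ∈ D, ∀ h z, applyVal ν (freeSkolem D m ρ h z) = sk ρ (applyVal ν ∘ h) z)
    {V : List Val} (hV : ∀ v ∈ V, applyVal ν v = v) {i : ℕ} {v : Val}
    (hv : v ∈ skolemValues D m sk V i) :
    ∃ u ∈ skolemValues D m (freeSkolem D m) V i, applyVal ν u = v := by
  induction i generalizing v with
  | zero => exact ⟨v, hv, hV v hv⟩
  | succ i ih =>
    rcases List.mem_append.1 hv with hv | hv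
    · obtain ⟨u, hu, rfl⟩ := ih hv
      exact ⟨u, List.mem_append_left _ hu, rfl⟩
    · simp only [List.mem_flatMap, List.mem_map] at hv
      obtain ⟨ρ, hρ, z, hz, e, he, rfl⟩ := hv
      obtain ⟨e', he', hee⟩ := exists_preimage_tuple (fun v hv => ih hv) he
      refine ⟨freeSkolem D m ρ (env e') z, List.mem_append_right _ ?_, ?_⟩
      · simp only [List.mem_flatMap, List.mem_map]
        exact ⟨ρ, hρ, z, hz, e', he', rfl⟩
      · rw [hν ρ hρ, hee]

theorem exists_preimage_candidates {V W : List Val} {ν : Null → Const}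
    (h : ∀ v ∈ V, ∃ u ∈ W, applyVal ν u = v) {β : DBFact} (hβ : β ∈ candidates D m V) :
    ∃ α ∈ candidates D m W, α.map (applyVal ν) = β := by
  simp only [candidates, List.mem_flatMap, List.mem_map] at hβ
  obtain ⟨ρ, hρ, a, ha, e, he, rfl⟩ := hβ
  obtain ⟨e', he', hee⟩ := exists_preimage_tuple h he
  refine ⟨_, List.mem_flatMap.2 ⟨ρ, hρ, List.mem_flatMap.2 ⟨a, ha, List.mem_map.2
    ⟨e', he', rfl⟩⟩⟩, ?_⟩
  rw [Atom.map_map, applyVal_inst, hee]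

/-! ### The conditional instance -/

open Classical in
/-- One round of the chase with free Skolem functions, within the candidate facts. -/
noncomputable def chaseRound (D : List TGD) (m : ℕ) (L : List DBFact) (V : List Val)
    (A : List DBFact) : List DBFact :=
  (candidates D m V).filter fun α => ∃ ρ ∈ D, ∃ e ∈ tuples V m,
    (∀ a ∈ ρ.body, a.map (Term.inst (env e)) ∈ L ++ A) ∧
      ∃ a ∈ ρ.head, α = a.map (Term.inst ((freeSkolem D m).extend ρ (env e)))

/-- The facts of the chase with free Skolem functions. -/
noncomputable def chaseList (D : List TGD) (m : ℕ) (L : List DBFact) (V : List Val) :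
    List DBFact :=
  (candidates D m V).foldl (fun A _ => chaseRound D m L V A) []

/-- The values of the chase with free Skolem functions, in `k` rounds. -/
noncomputable def freeValues (D : List TGD) (m k : ℕ) (L : List DBFact) : List Val :=
  skolemValues D m (freeSkolem D m) (baseValues D L) k

/-- The facts of the chase with free Skolem functions, and all the candidate facts with the
condition that they are chosen to hold. -/
noncomputable def condSolution (D : List TGD) (m k : ℕ) (L : List DBFact) : CInstance :=
  (chaseList D m L (freeValues D m k L)).map (fun α => (α, Condition.tru)) ++
    (candidates D m (freeValues D m k L)).map fun α =>
      (α, Condition.eq (flagNull α) (.const []))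

/-! ### The free chase as the limit of the rounds -/

theorem mem_chaseRound {L : List DBFact} {V : List Val} {A : List DBFact} {α : DBFact} :
    α ∈ chaseRound D m L V A ↔ α ∈ candidates D m V ∧ ∃ ρ ∈ D, ∃ e ∈ tuples V m,
      (∀ a ∈ ρ.body, a.map (Term.inst (env e)) ∈ L ++ A) ∧
        ∃ a ∈ ρ.head, α = a.map (Term.inst ((freeSkolem D m).extend ρ (env e))) := by
  simp only [chaseRound, List.mem_filter, decide_eq_true_eq]

/-- A round filters the fixed list of candidates and keeps its order and multiplicities. Growth is
thus a sublist relation, for which equal lengths force equality. -/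
theorem chaseRound_sublist {L : List DBFact} {V : List Val} {A B : List DBFact} (h : A ⊆ B) :
    (chaseRound D m L V A).Sublist (chaseRound D m L V B) := by
  refine List.monotone_filter_right _ fun α hα => ?_
  simp only [decide_eq_true_eq] at hα ⊢
  obtain ⟨ρ, hρ, e, he, hb, ha⟩ := hα
  refine ⟨ρ, hρ, e, he, fun a haa => ?_, ha⟩
  rcases List.mem_append.1 (hb a haa) with h1 | h1
  · exact List.mem_append_left _ h1
  · exact List.mem_append_right _ (h h1)

/-- An increasing sequence of bounded length becomes stationary. -/
theorem iterate_eq_of_sublist {α : Type} {f : List α → List α} {N : ℕ}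
    (hs : ∀ n, (f^[n] []).Sublist (f^[n + 1] [])) (hN : ∀ n, (f^[n] []).length ≤ N) :
    f (f^[N] []) = f^[N] [] := by
  have hex : ∃ n ≤ N, f^[n + 1] [] = f^[n] [] := by
    by_contra! hne
    -- As long as the sequence has not become stationary, every round adds at least one element.
    have : ∀ n ≤ N + 1, n ≤ (f^[n] []).length := by
      intro n
      induction n with
      | zero => simp
      | succ n ih =>
        intro hn
        have h1 := ih (by omega)
        have h2 := (hs n).length_le
        have h3 : (f^[n] []).length ≠ (f^[n + 1] []).length := fun e =>
          hne n (by omega) ((hs n).eq_of_length e).symm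
        omega
    have h1 := this (N + 1) le_rfl
    have h2 := hN (N + 1)
    omega
  obtain ⟨n, hn, e⟩ := hex
  rw [Function.iterate_succ_apply'] at e
  obtain ⟨k, rfl⟩ := Nat.exists_eq_add_of_le hn
  rw [Nat.add_comm, Function.iterate_add_apply, Function.iterate_fixed e, e]

theorem chaseList_eq (L : List DBFact) (V : List Val) :
    chaseList D m L V = (chaseRound D m L V)^[(candidates D m V).length] [] := by
  rw [chaseList, List.foldl_const]

theorem chaseRound_chaseList (L : List DBFact) (V : List Val) :
    chaseRound D m L V (chaseList D m L V) = chaseList D m L V := by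
  rw [chaseList_eq]
  refine iterate_eq_of_sublist (fun n => ?_) fun n => ?_
  · induction n with
    | zero => simp
    | succ n ih =>
      rw [Function.iterate_succ_apply', Function.iterate_succ_apply' _ (n + 1)]
      exact chaseRound_sublist ih.subset
  · cases n with
    | zero => simp
    | succ n =>
      rw [Function.iterate_succ_apply']
      exact List.length_filter_le _ _

theorem chaseList_subset_candidates {L : List DBFact} {V : List Val} {α : DBFact}
    (hα : α ∈ chaseList D m L V) : α ∈ candidates D m V := by
  rw [← chaseRound_chaseList] at hα
  exact (mem_chaseRound.1 hα).1

theorem chaseList_subset_chase {T : Set TGD} (hD : ∀ ρ ∈ D, ρ ∈ T) {L : List DBFact}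
    {V : List Val} {α : DBFact} (hα : α ∈ chaseList D m L V) :
    α ∈ chase T (freeSkolem D m) {α | α ∈ L} := by
  rw [chaseList_eq] at hα
  generalize (candidates D m V).length = n at hα
  induction n generalizing α with
  | zero => simp at hα
  | succ n ih =>
    rw [Function.iterate_succ_apply'] at hα
    obtain ⟨-, ρ, hρ, e, -, hb, a, ha, rfl⟩ := mem_chaseRound.1 hα
    exact mem_chase_of_isHom (hD ρ hρ) (fun b hbb => (List.mem_append.1 (hb b hbb)).imp id ih) ha

/-- `chaseList` is a fixed point of the round, so it is closed under the TGDs. Any assignment of a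
body is represented by a tuple over `V`, since the facts matched have arguments in `V`; locality
makes the invented nulls agree. -/
theorem chase_subset_chaseList {T : Set TGD} (hD : ∀ ρ ∈ T, ρ ∈ D)
    (hm : ∀ ρ ∈ D, ρ.BoundedBy m) {L : List DBFact} {V : List Val} (hV : .const [] ∈ V)
    (hL : ∀ α ∈ L, ∀ i, α.args i ∈ V)
    (hc : ∀ α ∈ chase T (freeSkolem D m) {α | α ∈ L}, α ∈ candidates D m V) {α : DBFact}
    (hα : α ∈ chase T (freeSkolem D m) {α | α ∈ L}) : α ∈ chaseList D m L V := by
  refine chase_induction (P := fun α => α ∈ chaseList D m L V) (fun ρ hρ h hb ih a ha => ?_) hα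
  obtain ⟨e, he, hev⟩ := exists_tuple_env m V hV h
  have hbody : ∀ x ∈ varsOf ρ.body, env e x = h x := by
    intro x hx
    refine hev x ((hm ρ (hD ρ hρ)).1 x hx) ?_
    obtain ⟨β, hβ, j, hj⟩ := ih.exists_arg hx
    rw [← hj]
    exact hβ.elim (fun h => hL β h j) fun h =>
      args_mem_of_mem_candidates hV (chaseList_subset_candidates h) j
  have hext : (freeSkolem D m).extend ρ (env e) = (freeSkolem D m).extend ρ h := by
    funext x
    by_cases hx : x ∈ varsOf ρ.body
    · rw [Skolem.extend_of_mem hx, Skolem.extend_of_mem hx, hbody x hx]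
    · rw [Skolem.extend_of_notMem hx, Skolem.extend_of_notMem hx,
        freeSkolem_local ρ (env e) h fun y hy => hbody y hy.1]
  rw [← chaseRound_chaseList]
  refine mem_chaseRound.2 ⟨hc _ (mem_chase_of_isHom hρ hb ha), ρ, hD ρ hρ, e, he,
    fun b hbb => ?_, a, ha, by rw [hext]⟩
  rw [Atom.inst_congr (τ := h) fun i x hx => hbody x ⟨b, hbb, i, hx⟩]
  exact List.mem_append.2 (ih b hbb)

end

/-! ### The conditional instance is computed in polynomial time -/

section
variable {ξ : Type} [Enc ξ] {D : List TGD} {m : ℕ}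

theorem PolyTime.code {v : ξ → Val} (hv : PolyTime v) : PolyTime fun x => (v x).code := by
  have hstr : PolyTime fun x => (v x).str := hv.of_enc.right.of_enc_eq fun x => by
    cases v x <;> rfl
  have hnull : PolyTime fun x => (v x).isNull := hv.of_enc.left.of_enc_eq fun x => by
    cases v x <;> rfl
  exact (PolyTime.flatMap (f := fun _ b => [true, b]) hstr
    ((PolyTime.const true).cons (PolyTime.id.snd.cons (.const [])))).append
    ((PolyTime.const false).cons (hnull.cons (.const [])))

theorem PolyTime.null_nullName {l : ξ → List Val} (hl : PolyTime l) :
    PolyTime fun x => Val.null (nullName (l x)) :=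
  ((PolyTime.const (Data.node .leaf .leaf)).pair (PolyTime.flatMap (f := fun _ v => v.code) hl
    PolyTime.id.snd.code)).of_enc_eq fun _ => rfl

theorem PolyTime.const_val {c : ξ → Const} (hc : PolyTime c) :
    PolyTime fun x => Val.const (c x) :=
  ((PolyTime.const Data.leaf).pair hc).of_enc_eq fun _ => rfl

theorem PolyTime.freeSkolem {h : ξ → Var → Val} (hh : ∀ y, PolyTime fun x => h x y) (ρ : TGD)
    (z : Var) : PolyTime fun x => freeSkolem D m ρ (h x) z :=
  PolyTime.null_nullName ((PolyTime.const _).cons ((PolyTime.const _).cons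
    ((PolyTime.const _).cons (PolyTime.list_fixed _ (f := fun y x => h x y) fun y _ => hh y))))

theorem PolyTime.extend_freeSkolem {h : ξ → Var → Val} (hh : ∀ y, PolyTime fun x => h x y)
    (ρ : TGD) (y : Var) : PolyTime fun x => (DataExchange.freeSkolem D m).extend ρ (h x) y := by
  by_cases hy : y ∈ varsOf ρ.body
  · exact (hh y).congr fun x => Skolem.extend_of_mem hy _
  · exact (PolyTime.freeSkolem hh ρ y).congr fun x => Skolem.extend_of_notMem hy _

theorem PolyTime.flagNull {α : ξ → DBFact} (hα : PolyTime α) :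
    PolyTime fun x => flagNull (α x) :=
  PolyTime.null_nullName ((PolyTime.const _).cons (hα.fact_name.const_val.cons hα.argList))

/-- A round multiplies the values and lengthens the names of nulls only polynomially, and the number
`i` of rounds is fixed. -/
theorem PolyTime.skolemValues {V : ξ → List Val} (hV : PolyTime V) (i : ℕ) :
    PolyTime fun x => skolemValues D m (DataExchange.freeSkolem D m) (V x) i := by
  induction i with
  | zero => exact hV
  | succ i ih =>
    refine ih.append (PolyTime.flatMap_fixed D (f := fun ρ x => (List.range m).flatMap fun z =>
      (DataExchange.tuples (DataExchange.skolemValues D m (DataExchange.freeSkolem D m) (V x) i)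
        m).map fun e => DataExchange.freeSkolem D m ρ (DataExchange.env e) z) fun ρ _ =>
      PolyTime.flatMap_fixed (List.range m) fun z _ => PolyTime.map (f := fun _ e =>
        DataExchange.freeSkolem D m ρ (DataExchange.env e) z) (ih.tuples m)
        (PolyTime.freeSkolem (fun y => PolyTime.id.snd.env y) ρ z))

theorem PolyTime.candidates {V : ξ → List Val} (hV : PolyTime V) :
    PolyTime fun x => candidates D m (V x) := by
  refine PolyTime.flatMap_fixed D (f := fun ρ x => ρ.head.flatMap fun a =>
    (DataExchange.tuples (V x) m).map fun e =>
      a.rel.generic.map (Term.inst (DataExchange.env e))) fun ρ _ => ?_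
  refine PolyTime.flatMap_fixed ρ.head (f := fun a x => (DataExchange.tuples (V x) m).map fun e =>
    a.rel.generic.map (Term.inst (DataExchange.env e))) fun a _ => ?_
  exact PolyTime.map (f := fun _ e => a.rel.generic.map (Term.inst (DataExchange.env e)))
    (hV.tuples m) (PolyTime.atom_inst (fun y => PolyTime.id.snd.env y) _)

theorem PolyTime.chaseRound {L : ξ → List DBFact} {V : ξ → List Val} {A : ξ → List DBFact}
    (hL : PolyTime L) (hV : PolyTime V) (hA : PolyTime A) :
    PolyTime fun x => chaseRound D m (L x) (V x) (A x) := by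
  classical
  refine PolyTime.filter (P := fun x α => ∃ ρ ∈ D, ∃ e ∈ DataExchange.tuples (V x) m,
    (∀ a ∈ ρ.body, a.map (Term.inst (DataExchange.env e)) ∈ L x ++ A x) ∧
      ∃ a ∈ ρ.head, α =
        a.map (Term.inst ((DataExchange.freeSkolem D m).extend ρ (DataExchange.env e))))
    hV.candidates (PolyTest.bex_fixed D fun ρ _ => PolyTest.bex (P := fun (p : ξ × DBFact) e =>
      (∀ a ∈ ρ.body, a.map (Term.inst (DataExchange.env e)) ∈ L p.1 ++ A p.1) ∧
      ∃ a ∈ ρ.head, p.2 =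
        a.map (Term.inst ((DataExchange.freeSkolem D m).extend ρ (DataExchange.env e))))
      ((hV.comp PolyTime.id.fst).tuples m) ((PolyTest.ball_fixed ρ.body fun a _ => ?_).and
        (PolyTest.bex_fixed ρ.head fun a _ => ?_)))
  · exact PolyTest.mem encFact_injective (PolyTime.atom_inst (fun y => PolyTime.id.snd.env y) a)
      ((hL.append hA).comp PolyTime.id.fst.fst)
  · exact PolyTest.eq encFact_injective PolyTime.id.fst.snd
      (PolyTime.atom_inst (PolyTime.extend_freeSkolem (fun y => PolyTime.id.snd.env y) ρ) a)

theorem PolyTime.chaseList {L : ξ → List DBFact} {V : ξ → List Val} (hL : PolyTime L)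
    (hV : PolyTime V) : PolyTime fun x => chaseList D m (L x) (V x) := by
  refine PolyTime.foldl (f := fun x A _ => DataExchange.chaseRound D m (L x) (V x) A)
    (hV.candidates (D := D) (m := m)) (.const []) (PolyTime.chaseRound (hL.comp PolyTime.id.fst)
      (hV.comp PolyTime.id.fst) PolyTime.id.snd.fst)
    (hV.candidates (D := D) (m := m)).polyBounded fun x A α _ => ?_
  -- Each round yields a sublist of the candidates, however large the previous list was.
  exact (sz_sublist (List.filter_sublist)).trans (Nat.le_add_left _ _)

theorem PolyTime.freeValues (k : ℕ) : PolyTime (freeValues D m k) :=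
  PolyTime.skolemValues ((PolyTime.const _).cons ((PolyTime.const _).append
    (PolyTime.flatMap (f := fun _ (α : DBFact) => α.argList) PolyTime.id
      PolyTime.id.snd.argList))) k

theorem PolyTime.condSolution (k : ℕ) : PolyTime (condSolution D m k) := by
  refine (PolyTime.map (f := fun _ α => (α, Condition.tru)) (PolyTime.chaseList PolyTime.id
    (PolyTime.freeValues k)) (PolyTime.id.snd.pair (.const _))).append
    (PolyTime.map (f := fun _ α => (α, Condition.eq (DataExchange.flagNull α) (.const [])))
      (PolyTime.freeValues k).candidates (PolyTime.id.snd.pair ?_))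
  exact ((PolyTime.const (encTag 2)).pair (PolyTime.id.snd.flagNull.pair
    (PolyTime.const (Val.const [])))).of_enc_eq fun _ => rfl

end

/-! ### The conditional instance is an approximate conditional solution -/

theorem finite_varsOf (A : List (Atom Term)) : (varsOf A).Finite := by
  refine (A.finite_toSet.biUnion fun a _ => Set.finite_range fun i =>
    match a.args i with | .const _ => 0 | .var x => x).subset ?_
  rintro x ⟨a, ha, i, hi⟩
  exact Set.mem_biUnion ha ⟨i, by simp [hi]⟩

theorem TGD.BoundedBy.mono {ρ : TGD} {m n : ℕ} (h : ρ.BoundedBy m) (hmn : m ≤ n) :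
    ρ.BoundedBy n :=
  ⟨fun x hx => (h.1 x hx).trans_le hmn, fun x hx => (h.2.1 x hx).trans_le hmn,
    fun a ha => (h.2.2 a ha).trans hmn⟩

theorem exists_boundedBy (D : List TGD) : ∃ m, ∀ ρ ∈ D, ρ.BoundedBy m := by
  induction D with
  | nil => exact ⟨0, by simp⟩
  | cons ρ D ih =>
    obtain ⟨m, hm⟩ := ih
    obtain ⟨b, hb⟩ := (finite_varsOf ρ.body).bddAbove
    obtain ⟨c, hc⟩ := (finite_varsOf ρ.head).bddAbove
    obtain ⟨d, hd⟩ := (ρ.head.finite_toSet.image fun a => a.rel.arity).bddAbove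
    refine ⟨m + b + c + d + 1, List.forall_mem_cons.2
      ⟨⟨fun x hx => ?_, fun x hx => ?_, fun a ha => ?_⟩, fun ρ' hρ' => (hm ρ' hρ').mono (by omega)⟩⟩
    · exact Nat.lt_of_le_of_lt (hb hx) (by omega)
    · exact Nat.lt_of_le_of_lt (hc hx) (by omega)
    · have : a.rel.arity ≤ d := hd ⟨a, ha, rfl⟩
      omega

section
variable {S : Setting} {D : List TGD} {m : ℕ} {L : List DBFact}

theorem map_applyVal_of_nullFree {I : Instance} (hI : NullFree I) (ν : Null → Const) :
    ∀ α ∈ I, α.map (applyVal ν) = α := by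
  rintro ⟨R, f⟩ hα
  simp only [Atom.map, Atom.mk.injEq, heq_eq_eq, true_and]
  funext i
  obtain ⟨c, hc⟩ : ∃ c, f i = .const c := hI _ hα i
  rw [hc]
  rfl

theorem Setting.finite_chase (hWA : S.WeaklyAcyclic) (hL : ∀ α ∈ L, α.rel ∈ S.source)
    (hD : ∀ ρ, ρ ∈ D ↔ ρ ∈ S.tgds) (hm : ∀ ρ ∈ D, ρ.BoundedBy m) {sk : Skolem}
    (hsk : sk.Local) : (chase S.tgds sk {α | α ∈ L}).Finite :=
  (List.finite_toSet _).subset fun _ hα => S.chase_subset_candidates hWA hL hD hm hsk hα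

/-- Flags are chosen so that a candidate is present exactly when its image lies in the given
solution. Every fact of the solution is the image of a candidate, and the unconditional facts map
into the solution because the valuation respects the Skolem functions. -/
theorem Setting.ssol_subset_pw (hTGD : S.TGDOnly) (hWA : S.WeaklyAcyclic)
    (hL : S.IsSourceInstance {α | α ∈ L}) (hD : ∀ ρ, ρ ∈ D ↔ ρ ∈ S.tgds)
    (hm : ∀ ρ ∈ D, ρ.BoundedBy m) :
    S.ssol {α | α ∈ L} ⊆ (condSolution D m S.depth L).pw := by
  intro J hJ
  obtain ⟨γ, rfl⟩ := (S.mem_ssol hTGD hL fun γ =>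
    S.finite_chase hWA hL.1.2 hD hm γ.skolem_local).1 hJ
  obtain ⟨ν, hsko, hflag⟩ := exists_valuation hm γ.skolem_local γ.skolem_const
    (chase S.tgds γ.skolem {α | α ∈ L})
  refine ⟨ν, Set.Subset.antisymm (fun β hβ => ?_) ?_⟩
  · have hbase : ∀ v ∈ baseValues D L, applyVal ν v = v := by
      intro v hv
      simp only [baseValues, List.mem_cons, List.mem_append, List.mem_flatMap, List.mem_map] at hv
      rcases hv with rfl | ⟨ρ, -, a, -, t, -, rfl⟩ | ⟨α, hα, hv⟩
      · rfl
      · cases t <;> rfl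
      · obtain ⟨i, rfl⟩ := Atom.mem_argList.1 hv
        obtain ⟨c, hc⟩ := hL.2 α hα i
        rw [hc]
        rfl
    obtain ⟨α, hα, rfl⟩ := exists_preimage_candidates
      (fun v hv => exists_preimage_skolemValues hsko hbase hv)
      (S.chase_subset_candidates hWA hL.1.2 hD hm γ.skolem_local hβ)
    exact ⟨_, List.mem_append_right _ (List.mem_map.2 ⟨α, hα, rfl⟩), (hflag α).2 hβ, rfl⟩
  · rintro _ ⟨p, hp, hsat, rfl⟩
    rcases List.mem_append.1 hp with hp | hp
    · obtain ⟨α, hα, rfl⟩ := List.mem_map.1 hp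
      exact map_mem_chase (fun _ _ _ _ _ _ => rfl) (fun _ _ _ _ _ _ => rfl)
        (map_applyVal_of_nullFree hL.2 ν) (fun ρ hρ h _ z _ => hsko ρ ((hD ρ).2 hρ) h z)
        (chaseList_subset_chase (fun ρ hρ => (hD ρ).1 hρ) hα)
    · obtain ⟨α, -, rfl⟩ := List.mem_map.1 hp
      exact (hflag α).1 hsat

/-- A chase for an ex-choice with fresh constants maps to the chase with free Skolem functions. -/
theorem Setting.exists_exChoice (S : Setting) (D : List TGD) (m : ℕ) {I : Instance}
    (hI : NullFree I) {B : Set Const}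
    (hB : B.Finite) (hIB : ∀ α ∈ I, ∀ i, ∀ c, α.args i = .const c → c ∈ B)
    (hDB : ∀ ρ ∈ S.tgds, ∀ a, a ∈ ρ.body ∨ a ∈ ρ.head → a.constSet ⊆ B) :
    ∃ (γ : ExChoice) (g : Val → Val), (∀ c ∈ B, g (.const c) = .const c) ∧
      ∀ α ∈ chase S.tgds γ.skolem I, α.map g ∈ chase S.tgds (freeSkolem D m) I := by
  classical
  obtain ⟨M, hM⟩ := (hB.image List.length).bddAbove
  -- The prefix makes these constants longer than all those in `B`; the rest of the string recovers
  -- the null.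
  let fresh (n : Null) : Const := List.replicate (M + 1) true ++ n
  have hfresh : ∀ n n', fresh n = fresh n' → n = n' := fun n n' h => List.append_cancel_left h
  have hBfresh : ∀ c ∈ B, ∀ n, fresh n ≠ c := by
    rintro c hc n rfl
    have : (fresh n).length ≤ M := hM ⟨_, hc, rfl⟩
    simp [fresh] at this
    omega
  let g : Val → Val := fun v => if h : ∃ n, .const (fresh n) = v then .null h.choose else v
  have hgfresh : ∀ n, g (.const (fresh n)) = .null n := by
    intro n
    have h : ∃ n', Val.const (fresh n') = .const (fresh n) := ⟨n, rfl⟩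
    simp only [g, dif_pos h, hfresh _ _ (Val.const.inj h.choose_spec)]
  have hgB : ∀ c ∈ B, g (.const c) = .const c := fun c hc =>
    dif_neg fun ⟨n, hn⟩ => hBfresh c hc n (Val.const.inj hn)
  -- The frontier is decoded first, and the chosen constant codes the free Skolem term over the
  -- decoded values. Decoding by `g` therefore turns the Skolem functions of `γ` into the free ones.
  let γ : ExChoice := fun ρ c z => fresh (nullName (skolemList D m ρ
    (fun x => if hx : x ∈ ρ.frontier then g (.const (c ⟨x, hx⟩)) else .const []) z))
  refine ⟨γ, g, hgB, fun α hα => map_mem_chase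
    (fun ρ hρ a ha c hc => hgB c (hDB ρ hρ a (.inl ha) hc))
    (fun ρ hρ a ha c hc => hgB c (hDB ρ hρ a (.inr ha) hc)) ?_ (fun ρ hρ h hh z hz => ?_) hα⟩
  · rintro ⟨R, f⟩ hα
    simp only [Atom.map, Atom.mk.injEq, heq_eq_eq, true_and]
    funext i
    obtain ⟨c, hc⟩ : ∃ c, f i = .const c := hI _ hα i
    rw [hc]
    exact hgB c (hIB _ hα i c hc)
  · rw [ExChoice.skolem, dif_pos hz, hgfresh]
    change freeSkolem D m ρ _ z = _
    rw [freeSkolem_local]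
    intro x hx
    obtain ⟨β, hβ, j, hj⟩ := hh.exists_arg hx.1
    obtain ⟨c, hc⟩ := hβ.elim (fun h => hI β h j) fun h => S.chase_nullFree hI γ β h j
    have hx' : h x = .const c := hj.symm.trans hc
    simp only [dif_pos hx, Function.comp_apply, hx', Val.toConst]

/-- It suffices to look at one solution, with fresh invented constants. A certain answer holds
there, and decoding carries it to the unconditional facts of the free chase. -/
theorem Setting.scert_subset_trueAnswers (hTGD : S.TGDOnly) (hWA : S.WeaklyAcyclic)
    (hL : S.IsSourceInstance {α | α ∈ L}) (hD : ∀ ρ, ρ ∈ D ↔ ρ ∈ S.tgds)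
    (hm : ∀ ρ ∈ D, ρ.BoundedBy m) {Q : Query} (hQ : Q.IsPositive) :
    S.scert {α | α ∈ L} Q ⊆ Q.trueAnswers (condSolution D m S.depth L) := by
  intro t ht
  let consts (v : Val) : Set Const := {c | v = .const c}
  have hconsts : ∀ v, (consts v).Finite := fun v =>
    Set.Subsingleton.finite fun c hc d hd => Val.const.inj (hc.symm.trans hd)
  -- Decoding must fix the constants of the instance and the TGDs, to be a homomorphism of chases,
  -- and those of the query and of the tuple `t`, to preserve this answer.
  let B : Set Const := ((⋃ α ∈ {α | α ∈ L}, ⋃ i, consts (α.args i)) ∪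
    (⋃ ρ ∈ {ρ | ρ ∈ D}, ⋃ a ∈ {a | a ∈ ρ.body ++ ρ.head}, a.constSet)) ∪
    (Q.formula.constSet ∪ ⋃ i, consts (t i))
  have hB : B.Finite :=
    (((List.finite_toSet L).biUnion fun α _ => Set.finite_iUnion fun i => hconsts _).union
    ((List.finite_toSet D).biUnion fun ρ _ => (List.finite_toSet _).biUnion fun a _ =>
      a.finite_constSet)).union (Q.formula.finite_constSet.union
        (Set.finite_iUnion fun i => hconsts _))
  obtain ⟨γ, g, hgB, hg⟩ := S.exists_exChoice D m hL.2 hB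
    (fun α hα i c hc => .inl (.inl (Set.mem_biUnion hα (Set.mem_iUnion.2 ⟨i, hc⟩))))
    (fun ρ hρ a ha c hc => .inl (.inr (Set.mem_biUnion ((hD ρ).2 hρ)
      (Set.mem_biUnion (List.mem_append.2 ha) hc))))
  have hJ := (S.mem_ssol hTGD hL fun γ => S.finite_chase hWA hL.1.2 hD hm γ.skolem_local).2 ⟨γ, rfl⟩
  have hans := Set.mem_iInter₂.1 ht _ hJ
  have hc : ∀ i, ∃ c, t i = .const c := by
    intro i
    obtain ⟨α, hα, j, hj⟩ := hans.1 i
    rw [← hj]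
    exact S.chase_nullFree hL.2 γ α hα j
  refine Query.mem_trueAnswers_of_hom hQ (g := g) (fun α hα => ?_)
    (fun c hc => hgB c (.inr (.inl hc))) hans hc fun i => ?_
  · refine List.mem_append_left _ (List.mem_map.2 ⟨_, ?_, rfl⟩)
    have hV := skolemValues_mono (D := D) (m := m) (sk := freeSkolem D m) (V := baseValues D L)
      (Nat.zero_le S.depth)
    exact chase_subset_chaseList (fun ρ hρ => (hD ρ).2 hρ) hm (hV default_mem_baseValues)
      (fun α hα i => hV (arg_mem_baseValues hα i))
      (fun α hα => S.chase_subset_candidates hWA hL.1.2 hD hm freeSkolem_local hα) (hg α hα)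
  · obtain ⟨c, hc⟩ := hc i
    rw [hc]
    exact hgB c (.inr (.inr (Set.mem_iUnion.2 ⟨i, hc⟩)))

end

theorem CInstance.ccert_subset_scert {S : Setting} {I : Instance} {J : CInstance}
    (h : S.ssol I ⊆ J.pw) (Q : Query) : J.ccert Q ⊆ S.scert I Q :=
  Set.biInter_subset_biInter_left h

end DataExchange

/-! ### Assembly of the corollary -/

theorem mainTheorem11 (S : Setting) (hTGD : S.TGDOnly) (hWA : S.WeaklyAcyclic) :
    ∃ F : List DBFact → CInstance,
      PolyTimeOn {L | S.IsSourceInstance {α | α ∈ L}} encFacts encCInstance F ∧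
      (∀ L : List DBFact, S.IsSourceInstance {α | α ∈ L} →
        S.IsApproxCondSol {α | α ∈ L} (F L)) ∧
      ∀ Q : Query, Q.Over S.target →
        (∀ L : List DBFact, S.IsSourceInstance {α | α ∈ L} →
          (Q.trueAnswers (F L) ⊆ (F L).ccert Q ∧
            (F L).ccert Q ⊆ S.scert {α | α ∈ L} Q) ∧
          (Q.IsPositive →
            Q.trueAnswers (F L) = (F L).ccert Q ∧
            (F L).ccert Q = S.scert {α | α ∈ L} Q)) ∧
        ∃ G : CInstance → List (Fin Q.arity → Val),
          PolyTimeOn Set.univ encCInstance encTuples G ∧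
          ∀ J : CInstance, {t | t ∈ G J} = Q.trueAnswers J := by
  have hfin : S.tgds.Finite := S.stTGDs_finite.union S.tgtTGDs_finite
  have hD : ∀ ρ, ρ ∈ hfin.toFinset.toList ↔ ρ ∈ S.tgds := by simp
  generalize hfin.toFinset.toList = D at hD
  obtain ⟨m, hm⟩ := exists_boundedBy D
  have hcert : ∀ (Q : Query) (L : List DBFact), S.IsSourceInstance {α | α ∈ L} →
      (Q.trueAnswers (condSolution D m S.depth L) ⊆ (condSolution D m S.depth L).ccert Q ∧
        (condSolution D m S.depth L).ccert Q ⊆ S.scert {α | α ∈ L} Q) ∧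
      (Q.IsPositive →
        Q.trueAnswers (condSolution D m S.depth L) = (condSolution D m S.depth L).ccert Q ∧
        (condSolution D m S.depth L).ccert Q = S.scert {α | α ∈ L} Q) := by
    intro Q L hL
    have h1 := Q.trueAnswers_subset_ccert (condSolution D m S.depth L)
    have h2 := CInstance.ccert_subset_scert (S.ssol_subset_pw hTGD hWA hL hD hm) Q
    refine ⟨⟨h1, h2⟩, fun hQ => ?_⟩
    -- This closes the circle of three inclusions, so all three sets of answers coincide.
    have h3 := S.scert_subset_trueAnswers hTGD hWA hL hD hm hQ
    exact ⟨h1.antisymm (h2.trans h3), h2.antisymm (h3.trans h1)⟩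
  refine ⟨condSolution D m S.depth, ?_, fun L hL => ⟨S.ssol_subset_pw hTGD hWA hL hD hm,
    fun Q _ => ⟨(hcert Q L hL).1.2, fun hQ => ((hcert Q L hL).2 hQ).2⟩⟩, fun Q _ => ⟨hcert Q, ?_⟩⟩
  · obtain ⟨p, P, hp⟩ := PolyTime.condSolution (D := D) (m := m) S.depth
    exact ⟨p, P, fun L _ => hp L trivial⟩
  · obtain ⟨n, hn⟩ := (Set.finite_range Q.head).bddAbove
    -- The largest answer variable is at most `n`, and tuples of length `n + 1` assign values to the
    -- variables up to `n`.
    exact ⟨Q.trueAnswersList (n + 1), Q.polyTime_trueAnswersList (n + 1), fun J =>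
      Set.ext (Q.mem_trueAnswersList (fun i => Nat.lt_succ_of_le (hn ⟨i, rfl⟩)) J)⟩
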